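/- Let $n\ge 0$ and let $I^n=[0,1]^n$ be the $n$-cube. A \emph{small cover over $I^n$} is a smooth closed (compact, Hausdorff, boundaryless) $n$-manifold $M$ with a smooth action of $\mathbb{Z}_2^n$ such that (a) the action is locally standard: every point of $M$ lies in an invariant open set $U$ that admits a diffeomorphism $e$ onto an open subset of $\mathbb{R}^n$ and an automorphism $\varphi$ of $\mathbb{Z}_2^n$ with $e(t\cdot y)=\varphi(t)\cdot e(y)$ for all $t\in\mathbb{Z}_2^n$, $y\in U$, where $\mathbb{Z}_2^n$ acts on $\mathbb{R}^n$ by sign changes of the coordinates; and (b) the orbit space is the cube: there is a homeomorphism $h:M/\mathbb{Z}_2^n\to I^n$ preserving the corner structure, i.e. for every $x\in M$ the isotropy group of $x$ has order $2^{k}$, where $k$ is the codimension of the minimal face of $I^n$ containing $h([x])$. Two small covers $M_1,M_2$ are $\mathbb{Z}_2^n$-equivariantly homeomorphic if there is a homeomorphism $f:M_1\to M_2$ with $f(t\cdot x)=t\cdot f(x)$ for all $t\in\mathbb{Z}_2^n$ and $x\in M_1$. Let $Q_n$ be the number of $\mathbb{Z}_2^n$-equivariant homeomorphism classes of small covers over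 $I^n$, and let $R_k$ be the number of acyclic digraphs (directed graphs with at most one edge from $i$ to $j$ for each ordered pair $(i,j)$, and with no directed cycle of any length, in particular without loops) on $k$ labeled nodes. Then $Q_n$ is finite and $$Q_n=\frac{\sum_{k=0}^{n}\binom nk 2^{k(n-k)}R_k}{2^n\,n!}\cdot\prod_{i=0}^{n-1}(2^n-2^i).$$ -/

import Mathlib

namespace SmallCovers

open scoped Manifold ContDiff

/-- The group `ℤ₂ⁿ`, written additively. -/
abbrev Z2 (n : ℕ) : Type := Fin n → ZMod 2

/-- The `n`-cube `Iⁿ = [0,1]ⁿ`. -/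
abbrev Cube (n : ℕ) : Type := Fin n → unitInterval

/-- The codimension of the minimal face of the cube containing `p`, i.e. the number of facets
`{p | p i = 0}`, `{p | p i = 1}` that contain `p`. -/
noncomputable def faceCodim {n : ℕ} (p : Cube n) : ℕ :=
  Set.ncard {i : Fin n | p i = 0 ∨ p i = 1}

/-- The standard action of `ℤ₂ⁿ` on `ℝⁿ`, by sign changes of the coordinates. -/
def standardAct {n : ℕ} (t : Z2 n) (y : EuclideanSpace ℝ (Fin n)) : EuclideanSpace ℝ (Fin n) :=
  WithLp.toLp 2 fun i => if t i = 0 then y i else -y i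

/-- A small cover over the `n`-cube: a smooth closed `n`-manifold with a smooth, locally standard
action of `ℤ₂ⁿ` whose orbit space is the `n`-cube. -/
structure SmallCover (n : ℕ) where
  carrier : Type
  [top : TopologicalSpace carrier]
  [t2 : T2Space carrier]
  [compact : CompactSpace carrier]
  [charted : ChartedSpace (EuclideanSpace ℝ (Fin n)) carrier]
  [smooth : IsManifold (𝓡 n) ∞ carrier]
  [action : AddAction (Z2 n) carrier]
  smooth_vadd : ∀ t : Z2 n, ContMDiff (𝓡 n) (𝓡 n) ∞ (fun x : carrier => t +ᵥ x)
  /-- Every point has an invariant open neighbourhood that is diffeomorphic to an (invariant) open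
  subset of `ℝⁿ` with the standard action, equivariantly up to an automorphism of `ℤ₂ⁿ`. -/
  locally_standard : ∀ x : carrier,
    ∃ e ∈ IsManifold.maximalAtlas (𝓡 n) ∞ carrier, x ∈ e.source ∧
      ∃ φ : Z2 n ≃+ Z2 n, ∀ t : Z2 n, ∀ y ∈ e.source,
        t +ᵥ y ∈ e.source ∧ e (t +ᵥ y) = standardAct (φ t) (e y)
  /-- The orbit space is homeomorphic to the cube, as a manifold with corners. The orbit space is
  locally modelled on `ℝⁿ / ℤ₂ⁿ = [0,∞)ⁿ`, and the orbit of `x` lies in a face of codimension `k`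
  (`k` coordinates vanish) exactly when the isotropy group of `x` has rank `k`; the homeomorphism
  has to preserve this codimension, and hence the faces. -/
  orbitSpace : ∃ h : AddAction.orbitRel.Quotient (Z2 n) carrier ≃ₜ Cube n,
    ∀ x : carrier, Nat.card (AddAction.stabilizer (Z2 n) x) =
      2 ^ faceCodim (h (Quotient.mk _ x))

attribute [instance] SmallCover.top SmallCover.t2 SmallCover.compact SmallCover.charted
  SmallCover.smooth SmallCover.action

/-- `ℤ₂ⁿ`-equivariant homeomorphism of small covers. -/
def SmallCover.EquivHomeo {n : ℕ} (M N : SmallCover n) : Prop :=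
  ∃ f : M.carrier ≃ₜ N.carrier, ∀ (t : Z2 n) (x : M.carrier), f (t +ᵥ x) = t +ᵥ f x

/-- The equivalence relation of being `ℤ₂ⁿ`-equivariantly homeomorphic. -/
instance SmallCover.setoid (n : ℕ) : Setoid (SmallCover n) where
  r := SmallCover.EquivHomeo
  iseqv :=
    { refl := fun M => ⟨Homeomorph.refl _, fun _ _ => rfl⟩
      symm := by
        rintro M N ⟨f, hf⟩
        refine ⟨f.symm, fun t x => ?_⟩
        apply f.injective
        rw [hf, f.apply_symm_apply, f.apply_symm_apply]
      trans := by
        rintro M N K ⟨f, hf⟩ ⟨g, hg⟩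
        refine ⟨f.trans g, fun t x => ?_⟩
        rw [Homeomorph.trans_apply, Homeomorph.trans_apply, hf, hg] }

/-- The number of `ℤ₂ⁿ`-equivariant homeomorphism classes of small covers over the `n`-cube. -/
noncomputable def numSmallCovers (n : ℕ) : ℕ :=
  Nat.card (Quotient (SmallCover.setoid n))

/-- A digraph is acyclic if no vertex can be reached from itself along a directed walk of positive
length; in particular there are no loops. -/
def IsAcyclic {V : Type} (G : Digraph V) : Prop :=
  ∀ v : V, ¬ Relation.TransGen G.Adj v v

/-- The number of acyclic digraphs with `k` labeled nodes. -/
noncomputable def numAcyclicDigraphs (k : ℕ) : ℕ :=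
  Nat.card {G : Digraph (Fin k) // IsAcyclic G}

end SmallCovers

/-! A small cover over the cube is encoded by a characteristic function: the label of a facet is the
unique nonzero element of `ℤ₂ⁿ` fixing the points over its relative interior, and the labels at each
vertex form a basis.

Labels exist because open facets are connected (`IsOrbitMap.exists_label`), and they generate all
isotropy groups because the action is locally standard (`IsOrbitMap.fixed_iff_mem_labelSpan`). The
orbit map has a global section (`IsOrbitMap.exists_section`), so equal labels give equivariantly
homeomorphic covers (`HasChar.equivHomeo`). An equivariant homeomorphism forgets the identification
of the orbit space with the cube, and two labellings of one cover differ by a symmetry of the cube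
(`HasChar.exists_cubeAut`). Every characteristic function is realized by the quotient of `ℝⁿ` by the
kernel of a homomorphism from a product of infinite dihedral groups to `ℤ₂ⁿ` (`Cover.smallCover`).
Hence classes of small covers correspond to orbits of characteristic functions under the group
`CubeAut n` of order `2ⁿ n!` (`nonempty_equiv_orbits`).

To count the orbits, take the labels `b i = l (i, false)`, an ordered basis with `∏ (2ⁿ - 2ⁱ)`
choices, and read the coordinates of `l (i, true) - l (i, false)` as row `i` of the adjacency matrix
of a digraph. Independence at all vertices means that the digraph is acyclic
(`isCharacteristic_labelOf_iff`). In Burnside's lemma a symmetry that permutes the coordinates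
nontrivially fixes nothing, since facets in different directions have different labels. Reversing
the coordinates outside a set `T` of size `k` fixes the labellings whose digraph has only sinks
outside `T`. Such a digraph is an acyclic digraph on `T` with arbitrary edges from `T` to its
complement, which gives `2^(k(n-k)) R_k` (`card_acyclic_sinks`). -/

namespace SmallCovers

open scoped Manifold ContDiff

/-! ### Facets of the cube -/

/-- A facet of the `n`-cube: `(i, false)` is `{p | p i = 0}` and `(i, true)` is `{p | p i = 1}`. -/
abbrev Facet (n : ℕ) : Type := Fin n × Bool

/-- The endpoints of the unit interval. -/
def bdry (b : Bool) : unitInterval := if b then 1 else 0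

/-- The points of a facet. -/
def facetSet {n : ℕ} (F : Facet n) : Set (Cube n) := {p | p F.1 = bdry F.2}

/-- The points of the relative interior of a facet. -/
def openFacet {n : ℕ} (F : Facet n) : Set (Cube n) :=
  {p | p F.1 = bdry F.2 ∧ ∀ j, j ≠ F.1 → p j ∈ Set.Ioo (0 : unitInterval) 1}

theorem bdry_injective : Function.Injective bdry := by
  intro a b h
  cases a <;> cases b <;> simp [bdry] at h ⊢

theorem mem_Ioo_iff_ne (x : unitInterval) : x ∈ Set.Ioo (0 : unitInterval) 1 ↔ ¬(x = 0 ∨ x = 1) := by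
  rw [not_or, Set.mem_Ioo, unitInterval.pos_iff_ne_zero, unitInterval.lt_one_iff_ne_one]

theorem eq_zero_or_one_iff (x : unitInterval) : (x = 0 ∨ x = 1) ↔ ∃ b, x = bdry b := by
  simp [bdry]

theorem not_bdry_mem_Ioo (b : Bool) : bdry b ∉ Set.Ioo (0 : unitInterval) 1 := by
  rw [mem_Ioo_iff_ne, not_not, eq_zero_or_one_iff]
  exact ⟨b, rfl⟩

theorem openFacet_subset {n : ℕ} (F : Facet n) : openFacet F ⊆ facetSet F := fun _ h => h.1

theorem isClosed_facetSet {n : ℕ} (F : Facet n) : IsClosed (facetSet F) :=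
  isClosed_eq (continuous_apply _) continuous_const

theorem openFacet_eq_pi {n : ℕ} (F : Facet n) :
    openFacet F = Set.pi Set.univ
      (fun j => if j = F.1 then {bdry F.2} else Set.Ioo (0 : unitInterval) 1) := by
  ext p
  simp only [openFacet, Set.mem_ofPred_eq, Set.mem_pi, Set.mem_univ, true_implies]
  constructor
  · rintro ⟨h1, h2⟩ j
    split_ifs with h
    · subst h; exact h1
    · exact h2 j h
  · intro h
    refine ⟨by simpa using h F.1, fun j hj => by simpa [hj] using h j⟩

theorem isPreconnected_openFacet {n : ℕ} (F : Facet n) : IsPreconnected (openFacet F) := by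
  rw [openFacet_eq_pi]
  apply isPreconnected_univ_pi
  intro j
  split_ifs
  · exact isPreconnected_singleton
  · exact isPreconnected_Ioo

theorem closure_openFacet {n : ℕ} (F : Facet n) : closure (openFacet F) = facetSet F := by
  rw [openFacet_eq_pi, closure_pi_set]
  ext p
  simp only [Set.mem_pi, Set.mem_univ, true_implies, facetSet, Set.mem_ofPred_eq]
  constructor
  · intro h
    simpa using h F.1
  · intro h j
    split_ifs with hj
    · subst hj; simpa using h
    · rw [closure_Ioo zero_ne_one]
      exact ⟨unitInterval.nonneg', unitInterval.le_one'⟩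

/-- The midpoint of the unit interval. -/
noncomputable def mid : unitInterval := ⟨1 / 2, by norm_num, by norm_num⟩

theorem mid_mem : mid ∈ Set.Ioo (0 : unitInterval) 1 := by
  constructor <;> rw [← Subtype.coe_lt_coe] <;> simp [mid]; norm_num

theorem openFacet_nonempty {n : ℕ} (F : Facet n) : (openFacet F).Nonempty :=
  ⟨fun j => if j = F.1 then bdry F.2 else mid, by simp, fun j hj => by simpa [hj] using mid_mem⟩

theorem mem_facetSet_of_mem_openFacet {n : ℕ} {F F' : Facet n} {p : Cube n} (h : p ∈ openFacet F)
    (h' : p ∈ facetSet F') : F' = F := by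
  obtain ⟨i, b⟩ := F
  obtain ⟨j, c⟩ := F'
  have hji : j = i := by
    by_contra hne
    have := h.2 j hne
    rw [show p j = bdry c from h'] at this
    exact not_bdry_mem_Ioo c this
  subst hji
  have : bdry b = bdry c := h.1.symm.trans h'
  rw [bdry_injective this]

theorem faceCodim_eq_one_iff {n : ℕ} (p : Cube n) :
    faceCodim p = 1 ↔ ∃ F : Facet n, p ∈ openFacet F := by
  rw [faceCodim, Set.ncard_eq_one]
  constructor
  · rintro ⟨i, hi⟩
    have h1 : i ∈ {i : Fin n | p i = 0 ∨ p i = 1} := by rw [hi]; rfl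
    obtain ⟨b, hb⟩ := (eq_zero_or_one_iff _).1 h1
    refine ⟨(i, b), hb, fun j hj => ?_⟩
    rw [mem_Ioo_iff_ne]
    intro h
    have : j ∈ ({i} : Set (Fin n)) := by rw [← hi]; exact h
    exact hj this
  · rintro ⟨F, hF⟩
    refine ⟨F.1, Set.ext fun j => ⟨fun h => ?_, fun h => ?_⟩⟩
    · by_contra hne
      exact (mem_Ioo_iff_ne _).1 (hF.2 j hne) h
    · rw [Set.mem_singleton_iff] at h
      subst h
      exact (eq_zero_or_one_iff _).2 ⟨_, hF.1⟩

/-- A preconnected set covered by finitely many closed sets that are pairwise disjoint on it lies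
in any one of them that it meets. -/
theorem _root_.IsPreconnected.subset_of_finite_closed_cover {X ι : Type*} [TopologicalSpace X]
    [Finite ι] {s : Set X} (hs : IsPreconnected s) {C : ι → Set X} (hC : ∀ i, IsClosed (C i))
    (hcov : s ⊆ ⋃ i, C i) (hdisj : ∀ i j, i ≠ j → ∀ x ∈ s, x ∈ C i → x ∉ C j)
    {i : ι} {x : X} (hx : x ∈ s) (hi : x ∈ C i) : s ⊆ C i := by
  intro y hy
  by_contra hyi
  have hcl : IsClosed (⋃ j : {j // j ≠ i}, C j) := isClosed_iUnion_of_finite fun j => hC j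
  have hmem : ∀ z ∈ s, z ∉ C i → z ∈ ⋃ j : {j // j ≠ i}, C j := by
    intro z hz hzi
    obtain ⟨j, hj⟩ := Set.mem_iUnion.1 (hcov hz)
    exact Set.mem_iUnion.2 ⟨⟨j, fun h => hzi (h ▸ hj)⟩, hj⟩
  obtain ⟨z, hz, hz1, hz2⟩ := isPreconnected_closed_iff.1 hs (C i) _ (hC i) hcl
    (fun z hz => by
      by_cases h : z ∈ C i
      · exact Or.inl h
      · exact Or.inr (hmem z hz h))
    ⟨x, hx, hi⟩ ⟨y, hy, hmem y hy hyi⟩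
  obtain ⟨⟨j, hj⟩, hzj⟩ := Set.mem_iUnion.1 hz2
  exact hdisj i j (Ne.symm hj) z hz hz1 hzj

/-! ### The characteristic function of a small cover -/

/-- A labelling of the facets is characteristic if the labels of the facets around each vertex are
linearly independent. -/
def IsCharacteristic {n : ℕ} (l : Facet n → Z2 n) : Prop :=
  ∀ v : Fin n → Bool, LinearIndependent (ZMod 2) fun i => l (i, v i)

/-- The orbit map of a small cover, with values in the cube. -/
structure IsOrbitMap {n : ℕ} (M : SmallCover n) (q : M.carrier → Cube n) : Prop where
  continuous : Continuous q
  surjective : Function.Surjective q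
  eq_iff : ∀ x y, q x = q y ↔ ∃ t : Z2 n, t +ᵥ x = y
  card_stabilizer : ∀ x, Nat.card (AddAction.stabilizer (Z2 n) x) = 2 ^ faceCodim (q x)

/-- The span of the labels of the facets through a point. -/
def labelSpan {n : ℕ} (l : Facet n → Z2 n) (p : Cube n) : Submodule (ZMod 2) (Z2 n) :=
  Submodule.span (ZMod 2) (l '' {F | p ∈ facetSet F})

/-- `l` is a characteristic function of `M`. -/
def HasChar {n : ℕ} (M : SmallCover n) (l : Facet n → Z2 n) : Prop :=
  ∃ q : M.carrier → Cube n, IsOrbitMap M q ∧ ∀ x (t : Z2 n), t +ᵥ x = x ↔ t ∈ labelSpan l (q x)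

theorem SmallCover.exists_isOrbitMap {n : ℕ} (M : SmallCover n) : ∃ q, IsOrbitMap M q := by
  obtain ⟨h, hh⟩ := M.orbitSpace
  refine ⟨fun x => h (Quotient.mk _ x), h.continuous.comp continuous_quotient_mk', ?_, ?_, hh⟩
  · exact h.surjective.comp Quotient.mk_surjective
  · intro x y
    rw [h.injective.eq_iff, eq_comm, Quotient.eq]
    exact Iff.rfl

theorem SmallCover.continuous_vadd {n : ℕ} (M : SmallCover n) (t : Z2 n) :
    Continuous fun x : M.carrier => t +ᵥ x := (M.smooth_vadd t).continuous

theorem SmallCover.isClosed_fixed {n : ℕ} (M : SmallCover n) (t : Z2 n) :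
    IsClosed {x : M.carrier | t +ᵥ x = x} := isClosed_eq (M.continuous_vadd t) continuous_id

namespace IsOrbitMap

variable {n : ℕ} {M : SmallCover n} {q : M.carrier → Cube n}

theorem isClosedMap (hq : IsOrbitMap M q) : IsClosedMap q := hq.continuous.isClosedMap

theorem isQuotientMap (hq : IsOrbitMap M q) : Topology.IsQuotientMap q :=
  hq.isClosedMap.isQuotientMap hq.continuous hq.surjective

theorem apply_vadd (hq : IsOrbitMap M q) (t : Z2 n) (x : M.carrier) : q (t +ᵥ x) = q x :=
  ((hq.eq_iff _ _).2 ⟨t, rfl⟩).symm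

theorem isOpenMap (hq : IsOrbitMap M q) : IsOpenMap q := by
  intro U hU
  rw [← hq.isQuotientMap.isOpen_preimage]
  have : q ⁻¹' (q '' U) = ⋃ t : Z2 n, (fun x => t +ᵥ x) ⁻¹' U := by
    ext x
    simp only [Set.mem_preimage, Set.mem_image, Set.mem_iUnion]
    constructor
    · rintro ⟨y, hy, hyx⟩
      obtain ⟨t, ht⟩ := (hq.eq_iff _ _).1 hyx.symm
      exact ⟨t, ht ▸ hy⟩
    · rintro ⟨t, ht⟩
      exact ⟨_, ht, hq.apply_vadd t x⟩
  rw [this]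
  exact isOpen_iUnion fun t => hU.preimage (M.continuous_vadd t)

theorem fixed_iff (hq : IsOrbitMap M q) {x y : M.carrier} (h : q x = q y) (t : Z2 n) :
    t +ᵥ x = x ↔ t +ᵥ y = y := by
  obtain ⟨s, rfl⟩ := (hq.eq_iff _ _).1 h
  rw [vadd_comm, vadd_left_cancel_iff]

theorem isClosed_image_fixed (hq : IsOrbitMap M q) (t : Z2 n) :
    IsClosed (q '' {x | t +ᵥ x = x}) := hq.isClosedMap _ (M.isClosed_fixed t)

theorem mem_image_fixed_iff (hq : IsOrbitMap M q) (t : Z2 n) (x : M.carrier) :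
    q x ∈ q '' {x | t +ᵥ x = x} ↔ t +ᵥ x = x := by
  constructor
  · rintro ⟨y, hy, hyx⟩
    exact (hq.fixed_iff hyx t).1 hy
  · intro h
    exact ⟨x, h, rfl⟩

/-- Over the relative interior of a facet the isotropy group has exactly one nonzero element. -/
theorem existsUnique_of_mem_openFacet (hq : IsOrbitMap M q) {F : Facet n} {x : M.carrier}
    (hx : q x ∈ openFacet F) : ∃ t : Z2 n, t ≠ 0 ∧ t +ᵥ x = x ∧ ∀ s, s ≠ 0 → s +ᵥ x = x → s = t := by
  have h1 : Nat.card (AddAction.stabilizer (Z2 n) x) = 2 := by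
    rw [hq.card_stabilizer, (faceCodim_eq_one_iff _).2 ⟨F, hx⟩, pow_one]
  obtain ⟨t, ht⟩ := (Nat.card_eq_two_iff' (0 : AddAction.stabilizer (Z2 n) x)).1 h1
  refine ⟨t, fun h => ht.1 (Subtype.ext h), t.2, fun s hs hsx => ?_⟩
  have := ht.2 ⟨s, hsx⟩ (fun h => hs (congrArg Subtype.val h))
  exact congrArg Subtype.val this

/-- Over the open facet the fixed sets of the nonzero elements have closed images, cover, and are
pairwise disjoint. The open facet is connected, so a single element fixes everything over it, and by
closedness everything over the facet. -/
theorem exists_label (hq : IsOrbitMap M q) (F : Facet n) : ∃ t : Z2 n, t ≠ 0 ∧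
    (∀ x, q x ∈ facetSet F → t +ᵥ x = x) ∧
    ∀ x, q x ∈ openFacet F → ∀ s : Z2 n, s ≠ 0 → s +ᵥ x = x → s = t := by
  obtain ⟨p, hp⟩ := openFacet_nonempty F
  obtain ⟨x, rfl⟩ := hq.surjective p
  obtain ⟨t, ht0, htx, -⟩ := hq.existsUnique_of_mem_openFacet hp
  have key : openFacet F ⊆ q '' {x | t +ᵥ x = x} := by
    refine (isPreconnected_openFacet F).subset_of_finite_closed_cover
      (ι := {t : Z2 n // t ≠ 0}) (C := fun t => q '' {x | t.1 +ᵥ x = x}) (i := ⟨t, ht0⟩)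
      (fun t => hq.isClosed_image_fixed _) ?_ ?_ hp ⟨x, htx, rfl⟩
    · intro p hp
      obtain ⟨y, rfl⟩ := hq.surjective p
      obtain ⟨s, hs0, hs, -⟩ := hq.existsUnique_of_mem_openFacet hp
      exact Set.mem_iUnion.2 ⟨⟨s, hs0⟩, y, hs, rfl⟩
    · intro s s' hne p hp hs hs'
      obtain ⟨y, rfl⟩ := hq.surjective p
      rw [hq.mem_image_fixed_iff] at hs hs'
      obtain ⟨r, -, -, hr⟩ := hq.existsUnique_of_mem_openFacet hp
      exact hne (Subtype.ext ((hr _ s.2 hs).trans (hr _ s'.2 hs').symm))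
  refine ⟨t, ht0, fun y hy => ?_, fun y hy s hs0 hs => ?_⟩
  · rw [← hq.mem_image_fixed_iff]
    rw [← closure_openFacet] at hy
    exact closure_minimal key (hq.isClosed_image_fixed t) hy
  · obtain ⟨r, -, -, hr⟩ := hq.existsUnique_of_mem_openFacet hy
    rw [hr s hs0 hs, hr t ht0 ((hq.mem_image_fixed_iff t y).1 (key hy))]

end IsOrbitMap

theorem ZMod_two_cases (a : ZMod 2) : a = 0 ∨ a = 1 := by
  fin_cases a
  · exact Or.inl rfl
  · exact Or.inr rfl

theorem standardAct_eq_self_iff {n : ℕ} (t : Z2 n) (y : EuclideanSpace ℝ (Fin n)) :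
    standardAct t y = y ↔ ∀ i, y i ≠ 0 → t i = 0 := by
  constructor
  · intro h i hi
    by_contra hti
    have := congrArg (fun z : EuclideanSpace ℝ (Fin n) => z i) h
    simp only [standardAct, if_neg hti] at this
    exact hi (by linarith)
  · intro h
    ext i
    simp only [standardAct]
    split_ifs with hti
    · rfl
    · have : y i = 0 := by
        by_contra hy
        exact hti (h i hy)
      simp [this]

theorem fixed_iff_of_chart {n : ℕ} {M : SmallCover n}
    {e : OpenPartialHomeomorph M.carrier (EuclideanSpace ℝ (Fin n))} {φ : Z2 n ≃+ Z2 n}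
    (he : ∀ t : Z2 n, ∀ y ∈ e.source,
        t +ᵥ y ∈ e.source ∧ e (t +ᵥ y) = standardAct (φ t) (e y))
    {y : M.carrier} (hy : y ∈ e.source) (t : Z2 n) :
    t +ᵥ y = y ↔ ∀ i, e y i ≠ 0 → φ t i = 0 := by
  rw [← standardAct_eq_self_iff, ← (he t y hy).2, e.injOn.eq_iff (he t y hy).1 hy]

namespace IsOrbitMap

variable {n : ℕ} {M : SmallCover n} {q : M.carrier → Cube n}

/-- In the chart, the only nonzero element fixing such a point is the reflection in the `i`-th
coordinate. The isotropy group has order two, so the point lies over a face of codimension one. -/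
theorem mem_openFacet_of_chart (hq : IsOrbitMap M q)
    {e : OpenPartialHomeomorph M.carrier (EuclideanSpace ℝ (Fin n))} {φ : Z2 n ≃+ Z2 n}
    (he : ∀ t : Z2 n, ∀ y ∈ e.source,
        t +ᵥ y ∈ e.source ∧ e (t +ᵥ y) = standardAct (φ t) (e y))
    {y : M.carrier} (hy : y ∈ e.source) {i : Fin n} (hi : ∀ j, e y j = 0 ↔ j = i) :
    ∃ F, q y ∈ openFacet F := by
  rw [← faceCodim_eq_one_iff]
  have hfix : ∀ t : Z2 n, t +ᵥ y = y ↔ t = 0 ∨ t = φ.symm (Pi.single i 1) := by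
    intro t
    rw [fixed_iff_of_chart he hy, AddEquiv.eq_symm_apply, ← φ.map_eq_zero_iff]
    constructor
    · intro h
      have h' : φ t = Pi.single i (φ t i) := by
        ext j
        by_cases hj : j = i
        · subst hj; simp
        · rw [Pi.single_eq_of_ne hj, h j (fun h0 => hj ((hi j).1 h0))]
      rcases ZMod_two_cases (φ t i) with h0 | h0
      · left; rw [h', h0, Pi.single_zero]
      · right; rw [h', h0]
    · rintro (h | h) j hj
      · rw [h]; rfl
      · rw [h, Pi.single_eq_of_ne (fun h0 => hj ((hi j).2 h0))]
  have hne : φ.symm (Pi.single i 1) ≠ 0 := by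
    intro h
    rw [φ.symm.map_eq_zero_iff] at h
    have := congrFun h i
    simp at this
  have hcard : Nat.card (AddAction.stabilizer (Z2 n) y) = 2 := by
    rw [Nat.card_eq_two_iff' 0]
    refine ⟨⟨φ.symm (Pi.single i 1), (hfix _).2 (Or.inr rfl)⟩, ?_, ?_⟩
    · intro h
      exact hne (congrArg Subtype.val h)
    · rintro ⟨s, hs⟩ hs0
      apply Subtype.ext
      exact ((hfix s).1 hs).resolve_left (fun h => hs0 (Subtype.ext h))
  rw [hq.card_stabilizer] at hcard
  exact Nat.pow_right_injective le_rfl (hcard.trans (pow_one 2).symm)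

theorem eventually_mem_facetSet (hq : IsOrbitMap M q) (x : M.carrier) :
    ∀ᶠ y in nhds x, ∀ F, q y ∈ facetSet F → q x ∈ facetSet F := by
  rw [Filter.eventually_all]
  intro F
  by_cases h : q x ∈ facetSet F
  · exact Filter.Eventually.of_forall fun _ _ => h
  · have : ∀ᶠ y in nhds x, q y ∈ (facetSet F)ᶜ :=
      hq.continuous.continuousAt.eventually_mem ((isClosed_facetSet F).isOpen_compl.mem_nhds h)
    filter_upwards [this] with y hy hy'
    exact absurd hy' hy

/-- Near a point with vanishing `i`-th coordinate in a locally standard chart there are points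
for which this is the only vanishing coordinate. -/
theorem exists_near_single_zero (x : M.carrier)
    (e : OpenPartialHomeomorph M.carrier (EuclideanSpace ℝ (Fin n)))
    (hx : x ∈ e.source) {i : Fin n} (hi : e x i = 0) {P : M.carrier → Prop}
    (hP : ∀ᶠ y in nhds x, P y) : ∃ y ∈ e.source, P y ∧ ∀ j, e y j = 0 ↔ j = i := by
  -- Moving by `ε • w` with `ε ≠ 0` makes all the other vanishing coordinates nonzero and leaves the
  -- remaining coordinates unchanged.
  let w : EuclideanSpace ℝ (Fin n) :=
    WithLp.toLp 2 fun j => if e x j = 0 ∧ j ≠ i then 1 else 0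
  have hγ : Filter.Tendsto (fun ε : ℝ => e x + ε • w) (nhds 0) (nhds (e x)) := by
    have : Continuous (fun ε : ℝ => e x + ε • w) := by fun_prop
    simpa using this.tendsto 0
  have h1 : ∀ᶠ ε : ℝ in nhds 0, e x + ε • w ∈ e.target :=
    hγ.eventually_mem (e.open_target.mem_nhds (e.map_source hx))
  have h2 : ∀ᶠ ε : ℝ in nhds 0, P (e.symm (e x + ε • w)) := by
    have := (e.continuousAt_symm (e.map_source hx)).tendsto.comp hγ
    rw [e.left_inv hx] at this
    exact this.eventually hP
  obtain ⟨ε, ⟨hε1, hε2⟩, hε⟩ :=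
    (((h1.and h2).filter_mono nhdsWithin_le_nhds).and
      (self_mem_nhdsWithin : {0}ᶜ ∈ nhdsWithin (0 : ℝ) {0}ᶜ)).exists
  have hε0 : ε ≠ 0 := hε
  refine ⟨_, e.map_target hε1, hε2, fun j => ?_⟩
  rw [e.right_inv hε1]
  simp only [PiLp.add_apply, PiLp.smul_apply, smul_eq_mul, w]
  by_cases hj : j = i
  · subst hj; simp [hi]
  · by_cases h0 : e x j = 0 <;> simp [h0, hj, hε0]

/-- In a standard chart the isotropy group is generated by the reflections in the vanishing
coordinates. Each of these is the entire nontrivial isotropy at a nearby point over an open facet,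
hence a label, and by nearness that facet also passes through `q x`. -/
theorem fixed_iff_mem_labelSpan (hq : IsOrbitMap M q) {l : Facet n → Z2 n}
    (hl : ∀ F x, q x ∈ facetSet F → l F +ᵥ x = x)
    (hl' : ∀ F x, q x ∈ openFacet F → ∀ s : Z2 n, s ≠ 0 → s +ᵥ x = x → s = l F)
    (x : M.carrier) (t : Z2 n) : t +ᵥ x = x ↔ t ∈ labelSpan l (q x) := by
  constructor
  · intro ht
    obtain ⟨e, -, hx, φ, he⟩ := M.locally_standard x
    rw [fixed_iff_of_chart he hx] at ht
    have hsum : t = ∑ i, φ.symm (Pi.single i (φ t i)) := by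
      rw [← map_sum, Finset.univ_sum_single, φ.symm_apply_apply]
    rw [hsum]
    refine Submodule.sum_mem _ fun i _ => ?_
    rcases ZMod_two_cases (φ t i) with h0 | h0
    · rw [h0, Pi.single_zero, map_zero]; exact Submodule.zero_mem _
    · have hi : e x i = 0 := by
        by_contra h
        rw [ht i h] at h0
        exact zero_ne_one h0
      obtain ⟨y, hy, hyP, hyi⟩ := exists_near_single_zero x e hx hi (hq.eventually_mem_facetSet x)
      obtain ⟨F, hF⟩ := hq.mem_openFacet_of_chart he hy hyi
      rw [h0]
      have : φ.symm (Pi.single i 1) = l F := by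
        apply hl' F y hF
        · intro h
          rw [φ.symm.map_eq_zero_iff] at h
          have := congrFun h i
          simp at this
        · rw [fixed_iff_of_chart he hy]
          intro j hj
          rw [φ.apply_symm_apply, Pi.single_eq_of_ne (fun h => hj ((hyi j).2 h))]
      rw [this]
      exact Submodule.subset_span ⟨F, hyP F (openFacet_subset F hF), rfl⟩
  · intro ht
    have : labelSpan l (q x) ≤
        AddSubgroup.toZModSubmodule 2 (AddAction.stabilizer (Z2 n) x) := by
      rw [labelSpan, Submodule.span_le]
      rintro _ ⟨F, hF, rfl⟩
      exact hl F x hF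
    exact this ht

end IsOrbitMap

theorem labelSpan_vertex {n : ℕ} (l : Facet n → Z2 n) (v : Fin n → Bool) :
    labelSpan l (fun i => bdry (v i)) = Submodule.span (ZMod 2) (Set.range fun i => l (i, v i)) := by
  rw [labelSpan]
  congr 1
  ext t
  constructor
  · rintro ⟨⟨i, b⟩, hF, rfl⟩
    have : bdry (v i) = bdry b := hF
    exact ⟨i, by simp only [bdry_injective this]⟩
  · rintro ⟨i, rfl⟩
    exact ⟨(i, v i), rfl, rfl⟩

theorem faceCodim_vertex {n : ℕ} (v : Fin n → Bool) :
    faceCodim (fun i => bdry (v i)) = n := by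
  rw [faceCodim, show {i : Fin n | bdry (v i) = 0 ∨ bdry (v i) = 1} = Set.univ from
    Set.eq_univ_of_forall fun i => (eq_zero_or_one_iff _).2 ⟨v i, rfl⟩]
  simp

/-- Over a vertex the isotropy group has order `2ⁿ` and is therefore everything. So the `n` labels
at a vertex span `ℤ₂ⁿ`, which makes them independent. -/
theorem SmallCover.exists_hasChar {n : ℕ} (M : SmallCover n) :
    ∃ l, IsCharacteristic l ∧ HasChar M l := by
  obtain ⟨q, hq⟩ := M.exists_isOrbitMap
  choose l _ hl hl' using hq.exists_label
  have hspan := hq.fixed_iff_mem_labelSpan hl hl'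
  refine ⟨l, fun v => ?_, q, hq, hspan⟩
  obtain ⟨x, hx⟩ := hq.surjective fun i => bdry (v i)
  have hcard := hq.card_stabilizer x
  rw [hx, faceCodim_vertex] at hcard
  have htop : AddAction.stabilizer (Z2 n) x = ⊤ := by
    apply AddSubgroup.eq_top_of_card_eq
    rw [hcard]
    simp
  apply linearIndependent_of_top_le_span_of_card_eq_finrank
  · intro t _
    rw [← labelSpan_vertex, ← hx, ← hspan]
    have : t ∈ AddAction.stabilizer (Z2 n) x := by rw [htop]; trivial
    exact this
  · simp

/-! ### Sections of the orbit map and uniqueness of the small cover -/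

/-- `q` has a continuous section over `K`. -/
def HasSectionOn {n : ℕ} {M : SmallCover n} (q : M.carrier → Cube n) (K : Set (Cube n)) : Prop :=
  ∃ s : Cube n → M.carrier, ContinuousOn s K ∧ ∀ p ∈ K, q (s p) = p

theorem HasSectionOn.mono {n : ℕ} {M : SmallCover n} {q : M.carrier → Cube n} {K L : Set (Cube n)}
    (h : HasSectionOn q L) (hKL : K ⊆ L) : HasSectionOn q K := by
  obtain ⟨s, hs, hs'⟩ := h
  exact ⟨s, hs.mono hKL, fun p hp => hs' p (hKL hp)⟩

/-- The coordinatewise absolute value. -/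
def coordAbs {n : ℕ} (y : EuclideanSpace ℝ (Fin n)) : EuclideanSpace ℝ (Fin n) :=
  WithLp.toLp 2 fun i => |y i|

theorem continuous_coordAbs {n : ℕ} : Continuous (coordAbs (n := n)) := by
  unfold coordAbs
  fun_prop

theorem coordAbs_standardAct {n : ℕ} (t : Z2 n) (y : EuclideanSpace ℝ (Fin n)) :
    coordAbs (standardAct t y) = coordAbs y := by
  ext i
  simp only [coordAbs, standardAct]
  split_ifs <;> simp

theorem exists_coordAbs_eq {n : ℕ} (y : EuclideanSpace ℝ (Fin n)) :
    ∃ t : Z2 n, coordAbs y = standardAct t y := by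
  refine ⟨fun i => if 0 ≤ y i then 0 else 1, ?_⟩
  ext i
  simp only [coordAbs, standardAct]
  by_cases h : 0 ≤ y i
  · simp [h]
  · simp [h, abs_of_neg (not_le.1 h)]

namespace IsOrbitMap

variable {n : ℕ} {M : SmallCover n} {q : M.carrier → Cube n}

/-- In a standard chart the coordinatewise absolute value selects one point of each orbit. The
resulting map `f` is constant on orbits and descends, since `q` is open. -/
theorem exists_local_section (hq : IsOrbitMap M q) (p : Cube n) :
    ∃ U : Set (Cube n), IsOpen U ∧ p ∈ U ∧ HasSectionOn q U := by
  classical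
  obtain ⟨x, rfl⟩ := hq.surjective p
  obtain ⟨e, -, hx, φ, he⟩ := M.locally_standard x
  let f : M.carrier → M.carrier := fun y => e.symm (coordAbs (e y))
  have hf : ∀ y ∈ e.source, coordAbs (e y) ∈ e.target ∧ ∃ t : Z2 n, f y = t +ᵥ y := by
    intro y hy
    obtain ⟨t, ht⟩ := exists_coordAbs_eq (e y)
    have h1 := he (φ.symm t) y hy
    rw [φ.apply_symm_apply, ← ht] at h1
    refine ⟨h1.2 ▸ e.map_source h1.1, φ.symm t, ?_⟩
    simp only [f]
    rw [← h1.2, e.left_inv h1.1]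
  have hfq : ∀ y ∈ e.source, q (f y) = q y := by
    intro y hy
    obtain ⟨t, ht⟩ := (hf y hy).2
    rw [ht, hq.apply_vadd]
  have hinv : ∀ y ∈ e.source, ∀ y' ∈ e.source, q y = q y' → f y = f y' := by
    intro y hy y' hy' h
    obtain ⟨t, rfl⟩ := (hq.eq_iff _ _).1 h
    simp only [f]
    rw [(he t y hy).2, coordAbs_standardAct]
  have hcont : ContinuousOn f e.source :=
    e.continuousOn_symm.comp (continuous_coordAbs.comp_continuousOn e.continuousOn)
      fun y hy => (hf y hy).1
  have hU : IsOpen (q '' e.source) := hq.isOpenMap _ e.open_source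
  let s : Cube n → M.carrier := fun p => if h : p ∈ q '' e.source then f h.choose else x
  have hs : ∀ y ∈ e.source, s (q y) = f y := by
    intro y hy
    have h : q y ∈ q '' e.source := ⟨y, hy, rfl⟩
    simp only [s, dif_pos h]
    exact hinv _ h.choose_spec.1 _ hy h.choose_spec.2
  refine ⟨q '' e.source, hU, ⟨x, hx, rfl⟩, s, ?_, ?_⟩
  · rw [continuousOn_open_iff hU]
    intro V hV
    have : q '' e.source ∩ s ⁻¹' V = q '' (e.source ∩ f ⁻¹' V) := by
      ext p
      constructor
      · rintro ⟨⟨y, hy, rfl⟩, hp⟩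
        exact ⟨y, ⟨hy, by rw [Set.mem_preimage, ← hs y hy]; exact hp⟩, rfl⟩
      · rintro ⟨y, ⟨hy, hy'⟩, rfl⟩
        exact ⟨⟨y, hy, rfl⟩, by rw [Set.mem_preimage, hs y hy]; exact hy'⟩
    rw [this]
    exact hq.isOpenMap _ (hcont.isOpen_inter_preimage e.open_source hV)
  · rintro _ ⟨y, hy, rfl⟩
    rw [hs y hy, hfq y hy]

theorem eq_zero_of_interior (hq : IsOrbitMap M q) {x : M.carrier}
    (hx : ∀ i, q x i ∈ Set.Ioo (0 : unitInterval) 1) {t : Z2 n} (ht : t +ᵥ x = x) : t = 0 := by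
  have h0 : faceCodim (q x) = 0 := by
    rw [faceCodim, Set.ncard_eq_zero]
    exact Set.eq_empty_of_forall_notMem fun i hi => (mem_Ioo_iff_ne _).1 (hx i) hi
  have h1 := hq.card_stabilizer x
  rw [h0, pow_zero] at h1
  have := (AddSubgroup.card_eq_one).1 h1
  have ht' : t ∈ AddAction.stabilizer (Z2 n) x := ht
  rwa [this, AddSubgroup.mem_bot] at ht'

/-- Over interior points the action is free, so on `I` the two sections differ by a unique group
element. By connectedness this element is constant on `I`, by continuity it works on `K ∩ L`, and
translating one section by it makes the two agree there. -/
theorem hasSectionOn_union (hq : IsOrbitMap M q) {K L I : Set (Cube n)} (hK : IsClosed K)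
    (hL : IsClosed L) (hsK : HasSectionOn q K) (hsL : HasSectionOn q L) (hI : IsPreconnected I)
    (hIK : I ⊆ K ∩ L) (hI' : ∀ p ∈ I, ∀ i, p i ∈ Set.Ioo (0 : unitInterval) 1)
    (hcl : K ∩ L ⊆ closure I) : HasSectionOn q (K ∪ L) := by
  classical
  obtain ⟨a, ha, hqa⟩ := hsK
  obtain ⟨b, hb, hqb⟩ := hsL
  let C : Z2 n → Set (Cube n) := fun t => {p | p ∈ K ∩ L ∧ t +ᵥ b p = a p}
  have hC : ∀ t, IsClosed (C t) := by
    intro t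
    have h1 : ContinuousOn (fun p => (t +ᵥ b p, a p)) (K ∩ L) :=
      ((M.continuous_vadd t).comp_continuousOn (hb.mono Set.inter_subset_right)).prodMk
        (ha.mono Set.inter_subset_left)
    exact h1.preimage_isClosed_of_isClosed (hK.inter hL) isClosed_diagonal
  have hcov : I ⊆ ⋃ t, C t := by
    intro p hp
    obtain ⟨t, ht⟩ := (hq.eq_iff (b p) (a p)).1
      ((hqb p (hIK hp).2).trans (hqa p (hIK hp).1).symm)
    exact Set.mem_iUnion.2 ⟨t, hIK hp, ht⟩
  have hdisj : ∀ t t', t ≠ t' → ∀ p ∈ I, p ∈ C t → p ∉ C t' := by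
    rintro t t' hne p hp ⟨-, h⟩ ⟨-, h'⟩
    apply hne
    rw [← sub_eq_zero]
    apply hq.eq_zero_of_interior (x := b p)
    · rw [hqb p (hIK hp).2]
      exact hI' p hp
    · rw [sub_eq_neg_add, add_vadd, h, ← h', neg_vadd_vadd]
  obtain ⟨t, ht⟩ : ∃ t, I ⊆ C t := by
    rcases I.eq_empty_or_nonempty with rfl | ⟨p, hp⟩
    · exact ⟨0, Set.empty_subset _⟩
    · obtain ⟨t, ht⟩ := Set.mem_iUnion.1 (hcov hp)
      exact ⟨t, hI.subset_of_finite_closed_cover hC hcov hdisj hp ht⟩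
  have hKL : K ∩ L ⊆ C t := hcl.trans (closure_minimal ht (hC t))
  refine ⟨fun p => if p ∈ K then a p else t +ᵥ b p, ?_, ?_⟩
  · apply ContinuousOn.union_of_isClosed _ _ hK hL
    · exact ha.congr fun p hp => if_pos hp
    · refine ((M.continuous_vadd t).comp_continuousOn hb).congr fun p hp => ?_
      by_cases h : p ∈ K
      · simp only [if_pos h]
        exact (hKL ⟨h, hp⟩).2.symm
      · simp only [if_neg h]; rfl
  · intro p hp
    by_cases h : p ∈ K
    · simp only [if_pos h]
      exact hqa p h
    · simp only [if_neg h]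
      rw [hq.apply_vadd]
      exact hqb p (hp.resolve_left h)

end IsOrbitMap

/-- The `k`-th of the points that divide the unit interval into `N` equal parts. -/
noncomputable def gridPt (N k : ℕ) : unitInterval :=
  ⟨min (k / N : ℝ) 1, by positivity, min_le_right _ _⟩

theorem gridPt_zero (N : ℕ) : gridPt N 0 = 0 := by
  ext; simp [gridPt]

theorem gridPt_self {N : ℕ} (hN : 0 < N) : gridPt N N = 1 := by
  ext
  simp [gridPt, hN.ne']

theorem gridPt_lt {N j k : ℕ} (hjk : j < k) (hk : k ≤ N) : gridPt N j < gridPt N k := by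
  have hN : (0 : ℝ) < N := by exact_mod_cast (by omega : 0 < N)
  rw [← Subtype.coe_lt_coe]
  have h1 : (k / N : ℝ) ≤ 1 := by
    rw [div_le_one hN]; exact_mod_cast hk
  have h2 : (j / N : ℝ) < k / N := by
    gcongr
  simp only [gridPt, min_eq_left h1, min_eq_left (h2.le.trans h1)]
  exact h2

theorem dist_le_of_mem_gridPt {N k : ℕ} {x : unitInterval}
    (hx : x ∈ Set.Icc (gridPt N k) (gridPt N (k + 1))) : dist x (gridPt N k) ≤ 1 / N := by
  have h1 : (gridPt N k : ℝ) ≤ x := hx.1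
  have h2 : (x : ℝ) ≤ gridPt N (k + 1) := hx.2
  rw [Subtype.dist_eq, Real.dist_eq, abs_of_nonneg (by linarith)]
  have h3 : (gridPt N (k + 1) : ℝ) ≤ gridPt N k + 1 / N := by
    simp only [gridPt]
    push_cast
    rw [add_div, ← min_add_add_right]
    apply min_le_min le_rfl
    have : (0 : ℝ) ≤ 1 / N := by positivity
    linarith
  linarith

namespace IsOrbitMap

variable {n : ℕ} {M : SmallCover n} {q : M.carrier → Cube n}

/-- The two halves meet in a common wall. Its relative interior `I` is connected, lies in the
interior of the cube because `a i < c < b i`, and is dense in the wall, as gluing requires. -/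
theorem hasSectionOn_box_of_split (hq : IsOrbitMap M q) {a b : Cube n} (hab : ∀ i, a i < b i)
    (i : Fin n) {c : unitInterval} (hac : a i < c) (hcb : c < b i)
    (h1 : HasSectionOn q (Set.Icc a (Function.update b i c)))
    (h2 : HasSectionOn q (Set.Icc (Function.update a i c) b)) :
    HasSectionOn q (Set.Icc a b) := by
  have hmem1 : ∀ p, p ∈ Set.Icc a (Function.update b i c) ↔ p ∈ Set.Icc a b ∧ p i ≤ c := by
    intro p
    simp only [Set.mem_Icc, Pi.le_def]
    constructor
    · rintro ⟨h, h'⟩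
      have hi : p i ≤ c := by simpa using h' i
      refine ⟨⟨h, fun j => ?_⟩, hi⟩
      by_cases hj : j = i
      · subst hj; exact hi.trans hcb.le
      · simpa [hj] using h' j
    · rintro ⟨⟨h, h'⟩, hi⟩
      refine ⟨h, fun j => ?_⟩
      by_cases hj : j = i
      · subst hj; simpa using hi
      · simpa [hj] using h' j
  have hmem2 : ∀ p, p ∈ Set.Icc (Function.update a i c) b ↔ p ∈ Set.Icc a b ∧ c ≤ p i := by
    intro p
    simp only [Set.mem_Icc, Pi.le_def]
    constructor
    · rintro ⟨h, h'⟩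
      have hi : c ≤ p i := by simpa using h i
      refine ⟨⟨fun j => ?_, h'⟩, hi⟩
      by_cases hj : j = i
      · subst hj; exact hac.le.trans hi
      · simpa [hj] using h j
    · rintro ⟨⟨h, h'⟩, hi⟩
      refine ⟨fun j => ?_, h'⟩
      by_cases hj : j = i
      · subst hj; simpa using hi
      · simpa [hj] using h j
  let I : Set (Cube n) := Set.pi Set.univ fun j => if j = i then {c} else Set.Ioo (a j) (b j)
  have hI : ∀ p, p ∈ I ↔ p i = c ∧ ∀ j, j ≠ i → p j ∈ Set.Ioo (a j) (b j) := by
    intro p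
    simp only [I, Set.mem_pi, Set.mem_univ, true_implies]
    constructor
    · intro h
      exact ⟨by simpa using h i, fun j hj => by simpa [hj] using h j⟩
    · rintro ⟨h, h'⟩ j
      split_ifs with hj
      · subst hj; exact h
      · exact h' j hj
  have hI' : ∀ p ∈ I, ∀ j, p j ∈ Set.Ioo (a j) (b j) := by
    intro p hp j
    obtain ⟨h, h'⟩ := (hI p).1 hp
    by_cases hj : j = i
    · subst hj; rw [h]; exact ⟨hac, hcb⟩
    · exact h' j hj
  have hun : Set.Icc a b = Set.Icc a (Function.update b i c) ∪ Set.Icc (Function.update a i c) b := by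
    ext p
    rw [Set.mem_union, hmem1, hmem2, ← and_or_left]
    exact ⟨fun h => ⟨h, le_total _ _⟩, fun h => h.1⟩
  rw [hun]
  refine hq.hasSectionOn_union (I := I) isClosed_Icc isClosed_Icc h1 h2 ?_ ?_ ?_ ?_
  · apply isPreconnected_univ_pi
    intro j
    split_ifs
    · exact isPreconnected_singleton
    · exact isPreconnected_Ioo
  · intro p hp
    have hp' : p ∈ Set.Icc a b := ⟨fun j => (hI' p hp j).1.le, fun j => (hI' p hp j).2.le⟩
    have hc := ((hI p).1 hp).1
    exact ⟨(hmem1 p).2 ⟨hp', hc.le⟩, (hmem2 p).2 ⟨hp', hc.ge⟩⟩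
  · intro p hp j
    exact ⟨unitInterval.nonneg'.trans_lt (hI' p hp j).1, (hI' p hp j).2.trans_le unitInterval.le_one'⟩
  · rintro p ⟨hp1, hp2⟩
    rw [hmem1] at hp1
    rw [hmem2] at hp2
    rw [closure_pi_set]
    intro j _
    simp only
    split_ifs with hj
    · subst hj
      simpa using le_antisymm hp1.2 hp2.2
    · rw [closure_Ioo (hab j).ne]
      exact ⟨hp1.1.1 j, hp1.1.2 j⟩

/-- The orbit map of a small cover over the cube has a continuous section. -/
theorem exists_section (hq : IsOrbitMap M q) :
    ∃ s : Cube n → M.carrier, Continuous s ∧ ∀ p, q (s p) = p := by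
  choose U hU hpU hsU using hq.exists_local_section
  obtain ⟨δ, hδ, hball⟩ := lebesgue_number_lemma_of_metric (isCompact_univ (X := Cube n)) hU
    (fun p _ => Set.mem_iUnion.2 ⟨p, hpU p⟩)
  obtain ⟨N, hN⟩ := exists_nat_one_div_lt hδ
  have hN' : 0 < N + 1 := N.succ_pos
  -- Induction on the total side length of a grid box. A box with all sides of one step lies in a
  -- Lebesgue ball, where a local section exists; any other box is split one step from its lower
  -- end.
  have key : ∀ m : ℕ, ∀ a b : Fin n → ℕ, (∀ i, a i < b i ∧ b i ≤ N + 1) →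
      ∑ i, (b i - a i) = m →
      HasSectionOn q (Set.Icc (fun i => gridPt (N + 1) (a i)) (fun i => gridPt (N + 1) (b i))) := by
    intro m
    induction m using Nat.strong_induction_on with
    | _ m ih =>
      intro a b hab hm
      by_cases h : ∃ i, a i + 1 < b i
      · obtain ⟨i, hi⟩ := h
        have hcomp : ∀ f : Fin n → ℕ, ∀ k, (fun j => gridPt (N + 1) (Function.update f i k j)) =
            Function.update (fun j => gridPt (N + 1) (f j)) i (gridPt (N + 1) k) := by
          intro f k
          ext1 j
          by_cases hj : j = i
          · subst hj; simp
          · simp [hj]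
        refine hq.hasSectionOn_box_of_split (c := gridPt (N + 1) (a i + 1))
          (fun j => gridPt_lt (hab j).1 (hab j).2) i
          (gridPt_lt (Nat.lt_succ_self _) (hi.le.trans (hab i).2)) (gridPt_lt hi (hab i).2) ?_ ?_
        · rw [← hcomp]
          refine ih _ ?_ _ _ ?_ rfl
          · rw [← hm]
            apply Finset.sum_lt_sum
            · intro j _
              by_cases hj : j = i
              · subst hj; simp; omega
              · simp [hj]
            · refine ⟨i, Finset.mem_univ _, ?_⟩
              simp; omega
          · intro j
            by_cases hj : j = i
            · subst hj; simp; have := (hab j).2; omega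
            · simpa [hj] using hab j
        · rw [← hcomp]
          refine ih _ ?_ _ _ ?_ rfl
          · rw [← hm]
            apply Finset.sum_lt_sum
            · intro j _
              by_cases hj : j = i
              · subst hj; simp; omega
              · simp [hj]
            · refine ⟨i, Finset.mem_univ _, ?_⟩
              simp; omega
          · intro j
            by_cases hj : j = i
            · subst hj; simp; exact ⟨hi, (hab j).2⟩
            · simpa [hj] using hab j
      · push Not at h
        obtain ⟨p, hp⟩ := hball (fun i => gridPt (N + 1) (a i)) (Set.mem_univ _)
        refine (hsU p).mono (fun x hx => hp ?_)
        rw [Metric.mem_ball, dist_pi_lt_iff hδ]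
        intro i
        have hb : b i = a i + 1 := le_antisymm (h i) (hab i).1
        have hx' : x i ∈ Set.Icc (gridPt (N + 1) (a i)) (gridPt (N + 1) (a i + 1)) :=
          ⟨hx.1 i, by rw [← hb]; exact hx.2 i⟩
        refine (dist_le_of_mem_gridPt hx').trans_lt ?_
        push_cast
        exact hN
  obtain ⟨s, hs, hqs⟩ := key _ (fun _ => 0) (fun _ => N + 1) (fun _ => ⟨hN', le_rfl⟩) rfl
  have huniv : (Set.Icc (fun _ => gridPt (N + 1) 0) (fun _ => gridPt (N + 1) (N + 1)) :
      Set (Cube n)) = Set.univ := by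
    refine Set.eq_univ_of_forall fun p => ⟨fun i => ?_, fun i => ?_⟩
    · rw [gridPt_zero]; exact unitInterval.nonneg'
    · rw [gridPt_self hN']; exact unitInterval.le_one'
  rw [huniv] at hs hqs
  exact ⟨s, continuousOn_univ.1 hs, fun p => hqs p trivial⟩

/-- Orbit maps with sections and equal isotropy groups give a continuous equivariant map. -/
theorem exists_map_of_section {N : SmallCover n} {r : N.carrier → Cube n} (hq : IsOrbitMap M q)
    (hst : ∀ x y, q x = r y → ∀ t : Z2 n, t +ᵥ x = x → t +ᵥ y = y)
    {s : Cube n → M.carrier} (hs : Continuous s) (hqs : ∀ p, q (s p) = p)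
    {s' : Cube n → N.carrier} (hs' : Continuous s') (hqs' : ∀ p, r (s' p) = p) :
    ∃ f : M.carrier → N.carrier, Continuous f ∧ ∀ (t : Z2 n) p, f (t +ᵥ s p) = t +ᵥ s' p := by
  have hex : ∀ x, ∃ t : Z2 n, t +ᵥ s (q x) = x := fun x =>
    (hq.eq_iff _ _).1 (hqs (q x))
  choose τ hτ using hex
  have hwd : ∀ (t t' : Z2 n) p, t +ᵥ s p = t' +ᵥ s p → t +ᵥ s' p = t' +ᵥ s' p := by
    intro t t' p h
    have h1 : (-t' + t) +ᵥ s p = s p := by rw [add_vadd, h, neg_vadd_vadd]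
    have h2 := hst (s p) (s' p) ((hqs p).trans (hqs' p).symm) _ h1
    rwa [add_vadd, neg_vadd_eq_iff] at h2
  refine ⟨fun x => τ x +ᵥ s' (q x), ?_, ?_⟩
  -- The choice `τ` need not be continuous. On each of the finitely many closed sets where a fixed
  -- `t` carries the section to `x`, the map agrees with the continuous one given by that `t`.
  · refine (locallyFinite_of_finite fun t : Z2 n => {x | t +ᵥ s (q x) = x}).continuous
      (Set.eq_univ_of_forall fun x => Set.mem_iUnion.2 ⟨τ x, hτ x⟩)
      (fun t => isClosed_eq ((M.continuous_vadd t).comp (hs.comp hq.continuous)) continuous_id) ?_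
    intro t
    refine ((N.continuous_vadd t).comp (hs'.comp hq.continuous)).continuousOn.congr ?_
    intro x hx
    exact hwd _ _ _ ((hτ x).trans (Eq.symm hx))
  · intro t p
    have hp : q (t +ᵥ s p) = p := (hq.apply_vadd _ _).trans (hqs p)
    have h1 := hτ (t +ᵥ s p)
    rw [hp] at h1
    simp only [hp]
    exact hwd _ _ _ h1

end IsOrbitMap

/-- Small covers with a common characteristic function are equivariantly homeomorphic. -/
theorem HasChar.equivHomeo {n : ℕ} {M N : SmallCover n} {l : Facet n → Z2 n} (hM : HasChar M l)
    (hN : HasChar N l) : M.EquivHomeo N := by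
  obtain ⟨q, hq, hql⟩ := hM
  obtain ⟨r, hr, hrl⟩ := hN
  obtain ⟨s, hs, hqs⟩ := hq.exists_section
  obtain ⟨s', hs', hrs⟩ := hr.exists_section
  have hst : ∀ x y, q x = r y → ∀ t : Z2 n, t +ᵥ x = x ↔ t +ᵥ y = y := by
    intro x y h t
    rw [hql, hrl, h]
  obtain ⟨f, hf, hfs⟩ := hq.exists_map_of_section (fun x y h t => (hst x y h t).1) hs hqs hs' hrs
  obtain ⟨g, hg, hgs⟩ := hr.exists_map_of_section (fun y x h t => (hst x y h.symm t).2) hs' hrs hs hqs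
  -- The translates of the sections exhaust both covers, so checking inverses and equivariance on
  -- them suffices.
  have hex : ∀ x, ∃ (t : Z2 n) (p : Cube n), t +ᵥ s p = x := fun x =>
    let ⟨t, ht⟩ := (hq.eq_iff _ _).1 (hqs (q x)); ⟨t, _, ht⟩
  have hex' : ∀ y, ∃ (t : Z2 n) (p : Cube n), t +ᵥ s' p = y := fun y =>
    let ⟨t, ht⟩ := (hr.eq_iff _ _).1 (hrs (r y)); ⟨t, _, ht⟩
  refine ⟨⟨⟨f, g, fun x => ?_, fun y => ?_⟩, hf, hg⟩, fun t x => ?_⟩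
  · obtain ⟨t, p, rfl⟩ := hex x
    rw [hfs, hgs]
  · obtain ⟨t, p, rfl⟩ := hex' y
    rw [hgs, hfs]
  · obtain ⟨u, p, rfl⟩ := hex x
    change f (t +ᵥ u +ᵥ s p) = t +ᵥ f (u +ᵥ s p)
    rw [← add_vadd, hfs, hfs, add_vadd]

/-! ### Symmetries of the cube and change of orbit map -/

/-- The opposite facet. -/
def opp {n : ℕ} (F : Facet n) : Facet n := (F.1, !F.2)

/-- The combinatorial symmetries of the cube: the permutations of the facets that respect the
relation of being opposite. -/
def CubeAut (n : ℕ) : Subgroup (Equiv.Perm (Facet n)) where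
  carrier := {σ | ∀ F, σ (opp F) = opp (σ F)}
  mul_mem' := by
    intro σ τ hσ hτ F
    rw [Equiv.Perm.mul_apply, hτ, hσ, Equiv.Perm.mul_apply]
  one_mem' := fun F => rfl
  inv_mem' := by
    intro σ hσ F
    rw [Equiv.Perm.inv_eq_iff_eq, hσ]
    simp

/-- The distance of a point of the cube from a facet. -/
def facetDist {n : ℕ} (F : Facet n) (p : Cube n) : unitInterval :=
  if F.2 then unitInterval.symm (p F.1) else p F.1

theorem facetDist_opp {n : ℕ} (F : Facet n) (p : Cube n) :
    facetDist (opp F) p = unitInterval.symm (facetDist F p) := by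
  obtain ⟨i, b⟩ := F
  cases b <;> simp [facetDist, opp]

theorem mem_facetSet_iff {n : ℕ} (F : Facet n) (p : Cube n) :
    p ∈ facetSet F ↔ facetDist F p = 0 := by
  obtain ⟨i, b⟩ := F
  cases b
  · simp [facetSet, facetDist, bdry]
  · simp [facetSet, facetDist, bdry]

/-- The homeomorphism of the cube given by a combinatorial symmetry. -/
def cubeMap {n : ℕ} (σ : Equiv.Perm (Facet n)) (p : Cube n) : Cube n :=
  fun i => facetDist (σ⁻¹ (i, false)) p

theorem continuous_cubeMap {n : ℕ} (σ : Equiv.Perm (Facet n)) : Continuous (cubeMap σ) := by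
  refine continuous_pi fun i => ?_
  unfold cubeMap facetDist
  split_ifs
  · exact unitInterval.continuous_symm.comp (continuous_apply _)
  · exact continuous_apply _

theorem facetDist_cubeMap {n : ℕ} {σ : Equiv.Perm (Facet n)} (hσ : σ ∈ CubeAut n) (F : Facet n)
    (p : Cube n) : facetDist F (cubeMap σ p) = facetDist (σ⁻¹ F) p := by
  obtain ⟨i, b⟩ := F
  cases b
  · simp [facetDist, cubeMap]
  · have h := (CubeAut n).inv_mem hσ (i, false)
    have h' : opp (i, false) = (i, true) := rfl
    rw [← h', h, facetDist_opp, facetDist_opp]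
    simp [facetDist, cubeMap]

theorem cubeMap_cubeMap_inv {n : ℕ} {σ : Equiv.Perm (Facet n)} (hσ : σ ∈ CubeAut n) (p : Cube n) :
    cubeMap σ (cubeMap σ⁻¹ p) = p := by
  ext1 i
  have h := facetDist_cubeMap ((CubeAut n).inv_mem hσ) (σ⁻¹ (i, false)) p
  rw [inv_inv, show σ (σ⁻¹ (i, false)) = (i, false) by simp] at h
  exact h

theorem mem_facetSet_cubeMap {n : ℕ} {σ : Equiv.Perm (Facet n)} (hσ : σ ∈ CubeAut n) (F : Facet n)
    (p : Cube n) : cubeMap σ p ∈ facetSet F ↔ p ∈ facetSet (σ⁻¹ F) := by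
  rw [mem_facetSet_iff, mem_facetSet_iff, facetDist_cubeMap hσ]

theorem faceCodim_eq_ncard {n : ℕ} (p : Cube n) :
    faceCodim p = Set.ncard {F : Facet n | p ∈ facetSet F} := by
  have h : {i : Fin n | p i = 0 ∨ p i = 1} = Prod.fst '' {F : Facet n | p ∈ facetSet F} := by
    ext i
    constructor
    · intro h
      obtain ⟨b, hb⟩ := (eq_zero_or_one_iff _).1 h
      exact ⟨(i, b), hb, rfl⟩
    · rintro ⟨F, hF, rfl⟩
      exact (eq_zero_or_one_iff _).2 ⟨F.2, hF⟩
  rw [faceCodim, h, Set.InjOn.ncard_image]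
  rintro ⟨i, b⟩ hF ⟨j, c⟩ hF' (rfl : i = j)
  have h1 : p i = bdry b := hF
  have h2 : p i = bdry c := hF'
  rw [bdry_injective (h1.symm.trans h2)]

/-- The small cover stays the same; its orbit map is composed with the homeomorphism `cubeMap σ`,
which permutes the facets by `σ`. -/
theorem HasChar.comp_inv {n : ℕ} {M : SmallCover n} {l : Facet n → Z2 n} (h : HasChar M l)
    {σ : Equiv.Perm (Facet n)} (hσ : σ ∈ CubeAut n) : HasChar M (fun F => l (σ⁻¹ F)) := by
  obtain ⟨q, hq, hql⟩ := h
  have hinj : Function.LeftInverse (cubeMap σ⁻¹) (cubeMap σ) := fun p => by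
    simpa using cubeMap_cubeMap_inv ((CubeAut n).inv_mem hσ) p
  have hset : ∀ p, {F | cubeMap σ p ∈ facetSet F} = σ '' {F | p ∈ facetSet F} := by
    intro p
    ext F
    simp only [Set.mem_ofPred_eq, mem_facetSet_cubeMap hσ, Set.mem_image]
    constructor
    · intro h
      exact ⟨_, h, by simp⟩
    · rintro ⟨F', h, rfl⟩
      simpa using h
  refine ⟨fun x => cubeMap σ (q x), ⟨(continuous_cubeMap σ).comp hq.continuous, ?_, ?_, ?_⟩, ?_⟩
  · exact Function.Surjective.comp (g := cubeMap σ) (fun p => ⟨_, cubeMap_cubeMap_inv hσ p⟩)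
      hq.surjective
  · intro x y
    rw [hinj.injective.eq_iff, hq.eq_iff]
  · intro x
    rw [hq.card_stabilizer, faceCodim_eq_ncard, faceCodim_eq_ncard, hset,
      Set.ncard_image_of_injective _ σ.injective]
  · intro x t
    rw [hql, labelSpan, labelSpan, hset, Set.image_image]
    simp

theorem HasChar.congr {n : ℕ} {M N : SmallCover n} {l : Facet n → Z2 n} (h : HasChar M l)
    (hMN : M.EquivHomeo N) : HasChar N l := by
  obtain ⟨q, hq, hql⟩ := h
  obtain ⟨f, hf⟩ := hMN
  have hf' : ∀ (t : Z2 n) y, f.symm (t +ᵥ y) = t +ᵥ f.symm y := by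
    intro t y
    rw [f.symm_apply_eq, hf, f.apply_symm_apply]
  have hfix : ∀ (t : Z2 n) y, t +ᵥ y = y ↔ t +ᵥ f.symm y = f.symm y := by
    intro t y
    rw [← hf', f.symm.injective.eq_iff]
  refine ⟨fun y => q (f.symm y), ⟨hq.continuous.comp f.symm.continuous,
    hq.surjective.comp f.symm.surjective, ?_, ?_⟩, ?_⟩
  · intro x y
    rw [hq.eq_iff]
    simp only [← hf', f.symm.injective.eq_iff]
  · intro y
    rw [← hq.card_stabilizer]
    congr 2
    ext t
    exact hfix t y
  · intro y t
    rw [hfix, hql]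

namespace IsOrbitMap

variable {n : ℕ} {M : SmallCover n} {q r : M.carrier → Cube n}

theorem exists_comparison (hq : IsOrbitMap M q) (hr : IsOrbitMap M r) :
    ∃ g : Cube n → Cube n, Continuous g ∧ ∀ x, g (q x) = r x := by
  choose s hs using hq.surjective
  have h : ∀ x, r (s (q x)) = r x := fun x =>
    (hr.eq_iff _ _).2 ((hq.eq_iff _ _).1 (hs (q x)))
  refine ⟨fun p => r (s p), ?_, h⟩
  rw [hq.isQuotientMap.continuous_iff]
  exact hr.continuous.congr fun x => (h x).symm

/-- The comparison of two orbit maps preserves the order of the isotropy group, so it sends an open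
facet into the union of the open facets. Connectedness leaves only one of them. -/
theorem exists_facet_of_comparison (hq : IsOrbitMap M q) (hr : IsOrbitMap M r) (F : Facet n) :
    ∃ F' : Facet n, (∀ x, q x ∈ openFacet F → r x ∈ openFacet F') ∧
      ∀ x, q x ∈ facetSet F → r x ∈ facetSet F' := by
  obtain ⟨g, hg, hgq⟩ := hq.exists_comparison hr
  have hstrat : ∀ p ∈ openFacet F, ∃ F', g p ∈ openFacet F' := by
    intro p hp
    obtain ⟨x, rfl⟩ := hq.surjective p
    rw [hgq, ← faceCodim_eq_one_iff]
    apply Nat.pow_right_injective le_rfl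
    simp only
    rw [← hr.card_stabilizer, hq.card_stabilizer, (faceCodim_eq_one_iff _).2 ⟨F, hp⟩]
  obtain ⟨p, hp⟩ := openFacet_nonempty F
  obtain ⟨F', hF'⟩ := hstrat p hp
  have key : openFacet F ⊆ g ⁻¹' facetSet F' := by
    refine (isPreconnected_openFacet F).subset_of_finite_closed_cover
      (C := fun F' => g ⁻¹' facetSet F') (fun F' => (isClosed_facetSet F').preimage hg) ?_ ?_ hp
      (openFacet_subset _ hF')
    · intro p hp
      obtain ⟨F', hF'⟩ := hstrat p hp
      exact Set.mem_iUnion.2 ⟨F', openFacet_subset _ hF'⟩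
    · intro F₁ F₂ hne p hp h₁ h₂
      obtain ⟨F', hF'⟩ := hstrat p hp
      exact hne ((mem_facetSet_of_mem_openFacet hF' h₁).trans
        (mem_facetSet_of_mem_openFacet hF' h₂).symm)
  refine ⟨F', fun x hx => ?_, fun x hx => ?_⟩
  · obtain ⟨F₁, h₁⟩ := hstrat _ hx
    rw [mem_facetSet_of_mem_openFacet h₁ (key hx), ← hgq]
    exact h₁
  · rw [← closure_openFacet] at hx
    have := closure_minimal key ((isClosed_facetSet F').preimage hg) hx
    rwa [Set.mem_preimage, hgq] at this

end IsOrbitMap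

theorem facetSet_inter_nonempty {n : ℕ} {F F' : Facet n} (h : F' ≠ opp F) :
    (facetSet F ∩ facetSet F').Nonempty := by
  refine ⟨fun j => if j = F.1 then bdry F.2 else bdry F'.2, by simp [facetSet], ?_⟩
  simp only [facetSet, Set.mem_ofPred_eq]
  split_ifs with h1
  · by_contra h2
    apply h
    refine Prod.ext h1 ?_
    have : F.2 ≠ F'.2 := fun h3 => h2 (by rw [h3])
    simp only [opp]
    exact (Bool.eq_not_iff).2 (Ne.symm this)
  · rfl

theorem facetSet_disjoint_opp {n : ℕ} {F : Facet n} {p : Cube n} (h : p ∈ facetSet F)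
    (h' : p ∈ facetSet (opp F)) : False := by
  have := bdry_injective ((show p F.1 = bdry F.2 from h).symm.trans (show p F.1 = bdry (!F.2) from h'))
  simp at this

theorem labelSpan_of_mem_openFacet {n : ℕ} (l : Facet n → Z2 n) {F : Facet n} {p : Cube n}
    (hp : p ∈ openFacet F) : labelSpan l p = Submodule.span (ZMod 2) {l F} := by
  have : {F' | p ∈ facetSet F'} = {F} := by
    ext F'
    exact ⟨fun h => mem_facetSet_of_mem_openFacet hp h, fun h => by
      rw [Set.mem_singleton_iff.1 h]; exact openFacet_subset _ hp⟩
  rw [labelSpan, this, Set.image_singleton]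

theorem eq_of_span_singleton_eq {V : Type*} [AddCommGroup V] [Module (ZMod 2) V] {a b : V}
    (ha : a ≠ 0)
    (h : Submodule.span (ZMod 2) {a} = Submodule.span (ZMod 2) {b}) : a = b := by
  have : a ∈ Submodule.span (ZMod 2) {b} := h ▸ Submodule.mem_span_singleton_self a
  obtain ⟨c, hc⟩ := Submodule.mem_span_singleton.1 this
  rcases ZMod_two_cases c with rfl | rfl
  · rw [zero_smul] at hc; exact absurd hc.symm ha
  · rw [one_smul] at hc; exact hc.symm

theorem IsCharacteristic.ne_zero {n : ℕ} {l : Facet n → Z2 n} (hl : IsCharacteristic l)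
    (F : Facet n) : l F ≠ 0 := (hl fun _ => F.2).ne_zero F.1

/-- Two characteristic functions of a small cover differ by a symmetry of the cube. -/
theorem HasChar.exists_cubeAut {n : ℕ} {M : SmallCover n} {l k : Facet n → Z2 n}
    (hl : IsCharacteristic l) (hMl : HasChar M l) (hMk : HasChar M k) :
    ∃ σ ∈ CubeAut n, ∀ F, k F = l (σ⁻¹ F) := by
  obtain ⟨q, hq, hql⟩ := hMl
  obtain ⟨r, hr, hrk⟩ := hMk
  choose σ hσ hσ' using hq.exists_facet_of_comparison hr
  choose τ hτ hτ' using hr.exists_facet_of_comparison hq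
  have hτσ : ∀ F, τ (σ F) = F := by
    intro F
    obtain ⟨p, hp⟩ := openFacet_nonempty F
    obtain ⟨x, rfl⟩ := hq.surjective p
    exact mem_facetSet_of_mem_openFacet hp (openFacet_subset _ (hτ _ x (hσ F x hp)))
  have hστ : ∀ F, σ (τ F) = F := by
    intro F
    obtain ⟨p, hp⟩ := openFacet_nonempty F
    obtain ⟨x, rfl⟩ := hr.surjective p
    exact mem_facetSet_of_mem_openFacet hp (openFacet_subset _ (hσ _ x (hτ F x hp)))
  refine ⟨⟨σ, τ, hτσ, hστ⟩, fun F => ?_, fun F => ?_⟩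
  -- A facet is disjoint from exactly one facet, its opposite, and the comparison maps preserve the
  -- relation of meeting.
  · change σ (opp F) = opp (σ F)
    by_contra h
    obtain ⟨p, hp, hp'⟩ := facetSet_inter_nonempty h
    obtain ⟨x, rfl⟩ := hr.surjective p
    have h1 := hτ' _ x hp
    have h2 := hτ' _ x hp'
    rw [hτσ] at h1 h2
    exact facetSet_disjoint_opp h1 h2
  · change k F = l (τ F)
    obtain ⟨p, hp⟩ := openFacet_nonempty F
    obtain ⟨x, rfl⟩ := hr.surjective p
    symm
    apply eq_of_span_singleton_eq (hl.ne_zero _)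
    rw [← labelSpan_of_mem_openFacet k hp, ← labelSpan_of_mem_openFacet l (hτ F x hp)]
    ext t
    rw [← hql, ← hrk]

theorem labelSpan_eq_span_range {n : ℕ} (l : Facet n → Z2 n) (p : Cube n) (v : Fin n → Bool)
    (hv : ∀ i b, p i = bdry b → v i = b) :
    labelSpan l p = Submodule.span (ZMod 2)
      (Set.range fun i : {i : Fin n | p i = 0 ∨ p i = 1} => l (i.1, v i.1)) := by
  rw [labelSpan]
  congr 1
  ext t
  constructor
  · rintro ⟨⟨i, b⟩, hF, rfl⟩
    exact ⟨⟨i, (eq_zero_or_one_iff _).2 ⟨b, hF⟩⟩, by simp only [hv i b hF]⟩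
  · rintro ⟨⟨i, hi⟩, rfl⟩
    obtain ⟨b, hb⟩ := (eq_zero_or_one_iff _).1 hi
    exact ⟨(i, b), hb, by simp only [hv i b hb]⟩

/-- The facets through `p` all contain a vertex `v` of the minimal face of `p`, so their labels are
part of a basis. -/
theorem card_labelSpan {n : ℕ} {l : Facet n → Z2 n} (hl : IsCharacteristic l) (p : Cube n) :
    Nat.card (labelSpan l p) = 2 ^ faceCodim p := by
  classical
  let v : Fin n → Bool := fun i => decide (p i = 1)
  have hv : ∀ i b, p i = bdry b → v i = b := by
    intro i b h
    cases b <;> simp [v, h, bdry]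
  have hli : LinearIndependent (ZMod 2)
      (fun i : {i : Fin n | p i = 0 ∨ p i = 1} => l (i.1, v i.1)) :=
    (hl v).comp Subtype.val Subtype.val_injective
  rw [labelSpan_eq_span_range l p v hv, Nat.card_eq_fintype_card,
    Module.card_eq_pow_finrank (K := ZMod 2), finrank_span_eq_card hli, ZMod.card, faceCodim,
    Set.ncard_eq_toFinset_card', Set.toFinset_card]

/-! ### Realization of a characteristic function by a reflection group -/

/-- The infinite dihedral group; the pair `(s, t)` acts on the line by `x ↦ s x + 2 t`. -/
@[ext]
structure Dinf where
  sgn : ℤˣ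
  tr : ℤ

namespace Dinf

instance : Mul Dinf := ⟨fun a b => ⟨a.sgn * b.sgn, a.sgn * b.tr + a.tr⟩⟩
instance : One Dinf := ⟨⟨1, 0⟩⟩
instance : Inv Dinf := ⟨fun a => ⟨a.sgn, -(a.sgn * a.tr)⟩⟩

theorem mul_sgn (a b : Dinf) : (a * b).sgn = a.sgn * b.sgn := rfl
theorem mul_tr (a b : Dinf) : (a * b).tr = a.sgn * b.tr + a.tr := rfl
theorem one_sgn : (1 : Dinf).sgn = 1 := rfl
theorem one_tr : (1 : Dinf).tr = 0 := rfl
theorem inv_sgn (a : Dinf) : a⁻¹.sgn = a.sgn := rfl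
theorem inv_tr (a : Dinf) : a⁻¹.tr = -(a.sgn * a.tr) := rfl

instance : Group Dinf := Group.ofLeftAxioms
  (by
    intro a b c
    ext
    · simp only [mul_sgn, mul_assoc]
    · simp only [mul_tr, mul_sgn, Units.val_mul]; ring)
  (by
    intro a
    ext
    · simp only [mul_sgn, one_sgn, one_mul]
    · simp [mul_tr, one_sgn, one_tr])
  (by
    intro a
    ext
    · simp only [mul_sgn, inv_sgn, one_sgn, Int.units_mul_self]
    · simp [mul_tr, inv_sgn, inv_tr, one_tr])

instance : MulAction Dinf ℝ where
  smul a x := ((a.sgn : ℤ) : ℝ) * x + 2 * a.tr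
  one_smul x := by
    change (((1 : ℤˣ) : ℤ) : ℝ) * x + 2 * ((0 : ℤ) : ℝ) = x
    simp
  mul_smul a b x := by
    change (((a.sgn * b.sgn : ℤˣ) : ℤ) : ℝ) * x + 2 * ((a.sgn * b.tr + a.tr : ℤ) : ℝ) =
      ((a.sgn : ℤ) : ℝ) * (((b.sgn : ℤ) : ℝ) * x + 2 * b.tr) + 2 * a.tr
    push_cast
    ring

theorem smul_def (a : Dinf) (x : ℝ) : a • x = ((a.sgn : ℤ) : ℝ) * x + 2 * a.tr := rfl

theorem smul_eq_self_iff (a : Dinf) (x : ℝ) : a • x = x ↔ a = 1 ∨ (a.sgn = -1 ∧ x = a.tr) := by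
  rcases Int.units_eq_one_or a.sgn with h | h
  · have h1 : a = 1 ↔ a.tr = 0 := by
      rw [Dinf.ext_iff, one_sgn, one_tr, and_iff_right h]
    rw [h1, smul_def, h]
    simp
  · have h1 : a ≠ 1 := by
      intro h0
      rw [h0, one_sgn] at h
      exact absurd h (by decide)
    rw [smul_def, h]
    simp only [h1, false_or, true_and]
    push_cast
    constructor <;> intro h2 <;> linarith

/-- The folding of the line onto the unit interval. -/
noncomputable def fold (x : ℝ) : unitInterval :=
  ⟨Real.arccos (Real.cos (Real.pi * x)) / Real.pi,
    div_nonneg (Real.arccos_nonneg _) Real.pi_pos.le,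
    (div_le_one Real.pi_pos).2 (Real.arccos_le_pi _)⟩

theorem continuous_fold : Continuous fold := by
  unfold fold
  refine Continuous.subtype_mk ?_ _
  exact (Real.continuous_arccos.comp (Real.continuous_cos.comp (by fun_prop))).div_const _

theorem fold_coe (p : unitInterval) : fold p = p := by
  ext
  simp only [fold]
  rw [Real.arccos_cos (mul_nonneg Real.pi_pos.le p.2.1)
    (by nlinarith [Real.pi_pos, p.2.2])]
  field_simp

/-- Equality of the folded values means `cos (π x) = cos (π y)`, that is, `y = ± x + 2 k` for an
integer `k`. -/
theorem fold_eq_iff (x y : ℝ) : fold x = fold y ↔ ∃ a : Dinf, a • x = y := by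
  have h1 : fold x = fold y ↔ Real.cos (Real.pi * x) = Real.cos (Real.pi * y) := by
    constructor
    · intro h
      have h2 := congrArg Subtype.val h
      simp only [fold] at h2
      have h3 := (div_left_inj' Real.pi_pos.ne').1 h2
      exact Real.arccos_injOn ⟨Real.neg_one_le_cos _, Real.cos_le_one _⟩
        ⟨Real.neg_one_le_cos _, Real.cos_le_one _⟩ h3
    · intro h
      ext
      simp only [fold, h]
  rw [h1, Real.cos_eq_cos_iff]
  have hpi := Real.pi_pos.ne'
  constructor
  · rintro ⟨k, h | h⟩
    · refine ⟨⟨1, k⟩, ?_⟩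
      rw [smul_def]
      apply mul_left_cancel₀ hpi
      rw [h]
      push_cast
      ring
    · refine ⟨⟨-1, k⟩, ?_⟩
      rw [smul_def]
      apply mul_left_cancel₀ hpi
      rw [h]
      push_cast
      ring
  · rintro ⟨a, rfl⟩
    refine ⟨a.tr, ?_⟩
    rcases Int.units_eq_one_or a.sgn with h | h
    · left
      rw [smul_def, h]
      push_cast
      ring
    · right
      rw [smul_def, h]
      push_cast
      ring

theorem fold_intCast (m : ℤ) (b : Bool) : fold m = bdry b ↔ (Odd m ↔ b = true) := by
  have h0 : ∀ b : Bool, bdry b = fold (if b then 1 else 0) := by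
    intro b
    rw [← fold_coe (bdry b)]
    congr 1
    cases b <;> simp [bdry]
  rw [h0, eq_comm, fold_eq_iff]
  constructor
  · rintro ⟨a, ha⟩
    rw [smul_def] at ha
    have ha' : (a.sgn : ℤ) * (if b then 1 else 0) + 2 * a.tr = m := by
      rw [← Int.cast_inj (α := ℝ), ← ha]
      push_cast
      rfl
    rw [← ha']
    rcases Int.units_eq_one_or a.sgn with h | h <;> cases b <;> simp [h, parity_simps]
  · intro h
    cases b
    · have h' : Even m := by
        rw [← Int.not_odd_iff_even, h]; simp
      obtain ⟨k, hk⟩ := h'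
      refine ⟨⟨1, k⟩, ?_⟩
      rw [smul_def, hk]
      push_cast
      simp; ring
    · obtain ⟨k, hk⟩ := h.2 rfl
      refine ⟨⟨1, k⟩, ?_⟩
      rw [smul_def, hk]
      push_cast
      simp; ring

theorem exists_int_of_fold_eq {x : ℝ} {b : Bool} (h : fold x = bdry b) : ∃ m : ℤ, x = m := by
  have h0 : bdry b = fold ((if b then 1 else 0 : ℤ) : ℝ) := by
    rw [← fold_coe (bdry b)]
    congr 1
    cases b <;> simp [bdry]
  rw [h0, eq_comm, fold_eq_iff] at h
  obtain ⟨a, rfl⟩ := h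
  exact ⟨a.sgn * (if b then 1 else 0) + 2 * a.tr, by rw [smul_def]; push_cast; rfl⟩

end Dinf

/-- The reflection group acting on `ℝⁿ` with fundamental domain the `n`-cube. -/
abbrev ReflGroup (n : ℕ) : Type := Fin n → Dinf

theorem ReflGroup.smul_apply {n : ℕ} (w : ReflGroup n) (x : EuclideanSpace ℝ (Fin n)) (i : Fin n) :
    (w • x) i = w i • x i := rfl

theorem ReflGroup.contDiff_smul {n : ℕ} (w : ReflGroup n) :
    ContDiff ℝ ∞ fun x : EuclideanSpace ℝ (Fin n) => w • x := by
  rw [contDiff_euclidean]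
  intro i
  simp only [ReflGroup.smul_apply, Dinf.smul_def]
  fun_prop

instance (n : ℕ) : ContinuousConstSMul (ReflGroup n) (EuclideanSpace ℝ (Fin n)) :=
  ⟨fun w => (ReflGroup.contDiff_smul w).continuous⟩

theorem Dinf.finite_tr_le (R : ℝ) : {a : Dinf | |(a.tr : ℝ)| ≤ R}.Finite := by
  have hinj : Function.Injective fun a : Dinf => (a.sgn, a.tr) := by
    intro a b h
    simp only [Prod.mk.injEq] at h
    exact Dinf.ext h.1 h.2
  refine Set.Finite.of_finite_image
    (((Set.finite_univ (α := ℤˣ)).prod (Set.finite_Icc (-⌈R⌉) ⌈R⌉)).subset ?_) hinj.injOn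
  rintro _ ⟨a, ha, rfl⟩
  have h := abs_le.1 (show |(a.tr : ℝ)| ≤ R from ha)
  refine ⟨trivial, ?_, ?_⟩
  · have : (-⌈R⌉ : ℝ) ≤ a.tr := by linarith [Int.le_ceil R]
    exact_mod_cast this
  · have : (a.tr : ℝ) ≤ ⌈R⌉ := by linarith [Int.le_ceil R]
    exact_mod_cast this

/-- A group element moving a bounded set to meet another has bounded translation parts, which leaves
finitely many. Passed on to the kernel of `rho`, this makes the quotient Hausdorff. -/
instance (n : ℕ) : ProperlyDiscontinuousSMul (ReflGroup n) (EuclideanSpace ℝ (Fin n)) where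
  finite_disjoint_inter_image := by
    intro A B hA hB
    obtain ⟨R, hR⟩ := hA.isBounded.exists_norm_le
    obtain ⟨S, hS⟩ := hB.isBounded.exists_norm_le
    refine (Set.Finite.pi' fun _ : Fin n => Dinf.finite_tr_le (R + S)).subset ?_
    rintro w ⟨_, ⟨x, hx, rfl⟩, hy⟩ i
    have h1 : |x i| ≤ R := by
      rw [← Real.norm_eq_abs]; exact (PiLp.norm_apply_le x i).trans (hR x hx)
    have h2 : |w i • x i| ≤ S := by
      rw [← Real.norm_eq_abs]; exact (PiLp.norm_apply_le (w • x) i).trans (hS _ hy)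
    rw [Dinf.smul_def] at h2
    have h3 : |(((w i).sgn : ℤ) : ℝ) * x i| = |x i| := by
      rcases Int.units_eq_one_or (w i).sgn with h | h <;> simp [h]
    have h4 : |(2 : ℝ) * (w i).tr| ≤ R + S := by
      have : (2 : ℝ) * (w i).tr = ((((w i).sgn : ℤ) : ℝ) * x i + 2 * (w i).tr) -
        (((w i).sgn : ℤ) : ℝ) * x i := by ring
      rw [this]
      refine (abs_sub _ _).trans ?_
      rw [h3]; linarith
    rw [abs_mul, abs_two] at h4
    have := abs_nonneg ((w i).tr : ℝ)
    change |((w i).tr : ℝ)| ≤ R + S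
    linarith

/-- The contribution of one coordinate to the homomorphism given by a labelling. -/
def rhoCoord {n : ℕ} (l : Facet n → Z2 n) (i : Fin n) (a : Dinf) : Z2 n :=
  (a.tr : ZMod 2) • (l (i, false) + l (i, true)) + (if a.sgn = 1 then 0 else l (i, false))

/-- The homomorphism that sends the reflection in a facet of the cube to its label. -/
def rho {n : ℕ} (l : Facet n → Z2 n) (w : ReflGroup n) : Z2 n := ∑ i, rhoCoord l i (w i)

theorem Z2_add_self {n : ℕ} (t : Z2 n) : t + t = 0 := by
  ext i
  exact CharTwo.add_self_eq_zero _

theorem rhoCoord_mul {n : ℕ} (l : Facet n → Z2 n) (i : Fin n) (a b : Dinf) :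
    rhoCoord l i (a * b) = rhoCoord l i a + rhoCoord l i b := by
  have h1 : (((a * b).tr : ℤ) : ZMod 2) = a.tr + b.tr := by
    rw [Dinf.mul_tr]
    rcases Int.units_eq_one_or a.sgn with h | h
    · rw [h]; push_cast; ring
    · rw [h]
      push_cast
      rw [neg_one_mul, CharTwo.neg_eq, add_comm]
  have h2 : (if (a * b).sgn = 1 then 0 else l (i, false)) =
      (if a.sgn = 1 then 0 else l (i, false)) + (if b.sgn = 1 then 0 else l (i, false)) := by
    rw [Dinf.mul_sgn]
    have hne : (-1 : ℤˣ) ≠ 1 := by decide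
    rcases Int.units_eq_one_or a.sgn with h | h <;> rcases Int.units_eq_one_or b.sgn with h' | h' <;>
      simp [h, h', hne, Z2_add_self]
  rw [rhoCoord, h1, h2, add_smul, rhoCoord, rhoCoord]
  abel

theorem rhoCoord_one {n : ℕ} (l : Facet n → Z2 n) (i : Fin n) : rhoCoord l i 1 = 0 := by
  simp [rhoCoord, Dinf.one_sgn, Dinf.one_tr]

/-- The element `⟨-1, m⟩` is the reflection of the line in the integer `m`, and `m` folds to the
endpoint `0` or `1` according to its parity. -/
theorem rhoCoord_reflection {n : ℕ} (l : Facet n → Z2 n) (i : Fin n) (m : ℤ) :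
    rhoCoord l i ⟨-1, m⟩ = l (i, decide (Odd m)) := by
  have hne : (-1 : ℤˣ) ≠ 1 := by decide
  simp only [rhoCoord, hne, if_false]
  by_cases h : Odd m
  · have : (m : ZMod 2) = 1 := by rwa [← ZMod.intCast_eq_one_iff_odd] at h
    simp only [this, one_smul, h, decide_true]
    rw [add_comm, ← add_assoc, Z2_add_self, zero_add]
  · have : (m : ZMod 2) = 0 := by
      rwa [Int.not_odd_iff_even, ← ZMod.intCast_eq_zero_iff_even] at h
    simp [this, h]

theorem rho_mul {n : ℕ} (l : Facet n → Z2 n) (w u : ReflGroup n) :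
    rho l (w * u) = rho l w + rho l u := by
  rw [rho, rho, rho, ← Finset.sum_add_distrib]
  exact Finset.sum_congr rfl fun i _ => rhoCoord_mul l i _ _

theorem rho_one {n : ℕ} (l : Facet n → Z2 n) : rho l 1 = 0 :=
  Finset.sum_eq_zero fun i _ => rhoCoord_one l i

theorem rho_inv {n : ℕ} (l : Facet n → Z2 n) (w : ReflGroup n) : rho l w⁻¹ = rho l w := by
  have h := rho_mul l w w⁻¹
  rw [mul_inv_cancel, rho_one] at h
  have h' := Z2_add_self (rho l w)
  exact add_left_cancel (h.symm.trans h'.symm)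

/-- The kernel of `rho`. -/
def rhoKer {n : ℕ} (l : Facet n → Z2 n) : Subgroup (ReflGroup n) where
  carrier := {w | rho l w = 0}
  mul_mem' := by
    intro w u hw hu
    change rho l (w * u) = 0
    rw [rho_mul, show rho l w = 0 from hw, show rho l u = 0 from hu, add_zero]
  one_mem' := rho_one l
  inv_mem' := by
    intro w hw
    exact (rho_inv l w).trans hw

instance {n : ℕ} (l : Facet n → Z2 n) :
    ContinuousConstSMul (rhoKer l) (EuclideanSpace ℝ (Fin n)) :=
  ⟨fun w => continuous_const_smul w.1⟩

instance {n : ℕ} (l : Facet n → Z2 n) :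
    ProperlyDiscontinuousSMul (rhoKer l) (EuclideanSpace ℝ (Fin n)) where
  finite_disjoint_inter_image := by
    intro A B hA hB
    have h := ProperlyDiscontinuousSMul.finite_disjoint_inter_image (Γ := ReflGroup n) hA hB
    exact Set.Finite.preimage (f := fun k : rhoKer l => k.1) Subtype.val_injective.injOn h

/-- The quotient of `ℝⁿ` by the kernel of `rho`, the underlying space of the small cover with
characteristic function `l`. -/
def Cover {n : ℕ} (l : Facet n → Z2 n) : Type :=
  MulAction.orbitRel.Quotient (rhoKer l) (EuclideanSpace ℝ (Fin n))

namespace Cover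

variable {n : ℕ} {l : Facet n → Z2 n}

instance : TopologicalSpace (Cover l) :=
  inferInstanceAs (TopologicalSpace (Quotient (MulAction.orbitRel (rhoKer l) _)))

instance : T2Space (Cover l) :=
  inferInstanceAs (T2Space (Quotient (MulAction.orbitRel (rhoKer l) _)))

/-- The projection of `ℝⁿ` onto `Cover l`. -/
def proj (l : Facet n → Z2 n) (x : EuclideanSpace ℝ (Fin n)) : Cover l :=
  Quotient.mk (MulAction.orbitRel (rhoKer l) _) x

theorem proj_surjective : Function.Surjective (proj l) := Quotient.mk_surjective

theorem continuous_proj : Continuous (proj l) := continuous_quotient_mk'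

theorem isOpenMap_proj : IsOpenMap (proj l) := isOpenMap_quotient_mk'_mul

theorem proj_eq_iff (x y : EuclideanSpace ℝ (Fin n)) :
    proj l x = proj l y ↔ ∃ w : ReflGroup n, rho l w = 0 ∧ w • x = y := by
  rw [eq_comm]
  refine Quotient.eq.trans ⟨?_, ?_⟩
  · rintro ⟨⟨w, hw⟩, h⟩
    exact ⟨w, hw, h⟩
  · rintro ⟨w, hw, h⟩
    exact ⟨⟨w, hw⟩, h⟩

/-- If `rho l w = rho l u` and `k` lies in the kernel, then so does `u k w⁻¹`. This is what makes
the action of `ℤ₂ⁿ` on the quotient well defined. -/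
theorem proj_smul_congr {w u : ReflGroup n} (h : rho l w = rho l u)
    {x y : EuclideanSpace ℝ (Fin n)} (hxy : proj l x = proj l y) :
    proj l (w • x) = proj l (u • y) := by
  obtain ⟨k, hk, rfl⟩ := (proj_eq_iff _ _).1 hxy
  rw [proj_eq_iff]
  refine ⟨u * k * w⁻¹, ?_, ?_⟩
  · rw [rho_mul, rho_mul, rho_inv, hk, h, add_zero, Z2_add_self]
  · rw [mul_smul, mul_smul, inv_smul_smul]

/-- The product of the reflections in the hyperplanes `x i = v i` with `s i ≠ 0`. -/
def refl (v : Fin n → Bool) (s : Z2 n) : ReflGroup n :=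
  fun i => if s i = 0 then 1 else ⟨-1, if v i then 1 else 0⟩

/-- A vertex of the cube. -/
def vtx (v : Fin n → Bool) : EuclideanSpace ℝ (Fin n) := WithLp.toLp 2 fun i => if v i then 1 else 0

theorem refl_smul (v : Fin n → Bool) (s : Z2 n) (z : EuclideanSpace ℝ (Fin n)) :
    refl v s • (z + vtx v) = standardAct s z + vtx v := by
  ext i
  rw [ReflGroup.smul_apply]
  simp only [refl, standardAct, PiLp.add_apply, vtx]
  split_ifs <;> simp [Dinf.smul_def]
  ring

theorem rho_refl (v : Fin n → Bool) (s : Z2 n) : rho l (refl v s) = ∑ i, s i • l (i, v i) := by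
  refine Finset.sum_congr rfl fun i _ => ?_
  rcases ZMod_two_cases (s i) with h | h
  · simp [refl, h, rhoCoord_one]
  · simp only [refl, h, one_ne_zero, if_false, one_smul, rhoCoord_reflection]
    cases v i <;> simp

/-- A point of the cube as a point of `ℝⁿ`. -/
def ofCube (p : Cube n) : EuclideanSpace ℝ (Fin n) := WithLp.toLp 2 fun i => (p i : ℝ)

theorem continuous_ofCube : Continuous (ofCube (n := n)) := by
  unfold ofCube
  fun_prop

theorem fold_eq_fold_iff (x y : EuclideanSpace ℝ (Fin n)) :
    (fun i => Dinf.fold (x i)) = (fun i => Dinf.fold (y i)) ↔ ∃ w : ReflGroup n, w • x = y := by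
  constructor
  · intro h
    choose w hw using fun i => (Dinf.fold_eq_iff _ _).1 (congrFun h i)
    exact ⟨w, by ext i; exact hw i⟩
  · rintro ⟨w, rfl⟩
    funext i
    exact (Dinf.fold_eq_iff _ _).2 ⟨w i, rfl⟩

/-- The orbit map of `Cover l`. -/
noncomputable def foldMap (l : Facet n → Z2 n) : Cover l → Cube n :=
  Quotient.lift (s := MulAction.orbitRel (rhoKer l) _) (fun x i => Dinf.fold (x i)) (by
    rintro x y ⟨w, rfl⟩
    exact ((fold_eq_fold_iff _ _).2 ⟨w.1, rfl⟩).symm)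

theorem foldMap_proj (x : EuclideanSpace ℝ (Fin n)) :
    foldMap l (proj l x) = fun i => Dinf.fold (x i) := rfl

theorem continuous_foldMap : Continuous (foldMap l) :=
  Continuous.quotient_lift (continuous_pi fun i => Dinf.continuous_fold.comp (by fun_prop)) _

theorem foldMap_ofCube (p : Cube n) : foldMap l (proj l (ofCube p)) = p := by
  rw [foldMap_proj]
  funext i
  exact Dinf.fold_coe _

theorem foldMap_surjective : Function.Surjective (foldMap l) := fun p => ⟨_, foldMap_ofCube p⟩

variable [hl : Fact (IsCharacteristic l)]

/-- The labels around a vertex, as a basis. -/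
noncomputable def vertexBasis (l : Facet n → Z2 n) [hl : Fact (IsCharacteristic l)]
    (v : Fin n → Bool) : Module.Basis (Fin n) (ZMod 2) (Z2 n) :=
  basisOfLinearIndependentOfCardEqFinrank' (fun i => l (i, v i)) (hl.out v) (by simp)

/-- The coordinates with respect to the labels around a vertex. -/
noncomputable def vertexEquiv (l : Facet n → Z2 n) [Fact (IsCharacteristic l)] (v : Fin n → Bool) :
    Z2 n ≃+ Z2 n := (vertexBasis l v).equivFun.toAddEquiv

theorem rho_refl_vertexEquiv (v : Fin n → Bool) (t : Z2 n) :
    rho l (refl v (vertexEquiv l v t)) = t := by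
  rw [rho_refl]
  have h := (vertexBasis l v).sum_equivFun t
  simpa [vertexEquiv, vertexBasis] using h

theorem exists_rho_eq (l : Facet n → Z2 n) [Fact (IsCharacteristic l)] (t : Z2 n) :
    ∃ w : ReflGroup n, rho l w = t :=
  ⟨_, rho_refl_vertexEquiv (l := l) (fun _ => false) t⟩

/-- The action of an element of `ℤ₂ⁿ`, induced by any of its preimages under `rho`. -/
noncomputable def act (t : Z2 n) : Cover l → Cover l :=
  Quotient.lift (s := MulAction.orbitRel (rhoKer l) _)
    (fun x => proj l ((exists_rho_eq l t).choose • x))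
    fun _ _ h => proj_smul_congr rfl (Quotient.sound h)

theorem act_proj (w : ReflGroup n) (x : EuclideanSpace ℝ (Fin n)) :
    act (rho l w) (proj l x) = proj l (w • x) :=
  proj_smul_congr (exists_rho_eq l (rho l w)).choose_spec rfl

noncomputable instance : AddAction (Z2 n) (Cover l) where
  vadd := act
  zero_vadd m := by
    obtain ⟨x, rfl⟩ := proj_surjective m
    have h := act_proj (l := l) 1 x
    rw [rho_one, one_smul] at h
    exact h
  add_vadd t s m := by
    obtain ⟨x, rfl⟩ := proj_surjective m
    obtain ⟨w, rfl⟩ := exists_rho_eq l t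
    obtain ⟨u, rfl⟩ := exists_rho_eq l s
    change act _ _ = act _ (act _ _)
    rw [act_proj, act_proj, ← rho_mul, act_proj, mul_smul]

theorem vadd_proj {w : ReflGroup n} {t : Z2 n} (h : rho l w = t) (x : EuclideanSpace ℝ (Fin n)) :
    t +ᵥ proj l x = proj l (w • x) := by
  subst h
  exact act_proj w x

theorem vadd_proj_vertex (v : Fin n → Bool) (t : Z2 n) (z : EuclideanSpace ℝ (Fin n)) :
    t +ᵥ proj l (z + vtx v) = proj l (standardAct (vertexEquiv l v t) z + vtx v) := by
  rw [vadd_proj (rho_refl_vertexEquiv v t), refl_smul]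

theorem foldMap_eq_iff (m m' : Cover l) : foldMap l m = foldMap l m' ↔ ∃ t : Z2 n, t +ᵥ m = m' := by
  obtain ⟨x, rfl⟩ := proj_surjective m
  obtain ⟨y, rfl⟩ := proj_surjective m'
  rw [foldMap_proj, foldMap_proj, fold_eq_fold_iff]
  constructor
  · rintro ⟨w, rfl⟩
    exact ⟨_, vadd_proj rfl x⟩
  · rintro ⟨t, ht⟩
    obtain ⟨w, rfl⟩ := exists_rho_eq l t
    rw [vadd_proj rfl, proj_eq_iff] at ht
    obtain ⟨k, -, hk⟩ := ht
    exact ⟨k * w, by rw [mul_smul, hk]⟩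

theorem exists_vadd_ofCube (m : Cover l) : ∃ (t : Z2 n) (p : Cube n), m = t +ᵥ proj l (ofCube p) := by
  obtain ⟨t, ht⟩ := (foldMap_eq_iff _ m).1 (foldMap_ofCube (foldMap l m))
  exact ⟨t, _, ht.symm⟩

theorem continuous_vadd (t : Z2 n) : Continuous fun m : Cover l => t +ᵥ m := by
  obtain ⟨w, rfl⟩ := exists_rho_eq l t
  refine (isOpenMap_proj.isQuotientMap continuous_proj proj_surjective).continuous_iff.2 ?_
  exact (continuous_proj.comp (continuous_const_smul w)).congr fun x => (vadd_proj rfl x).symm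

theorem fixed_proj_iff (x : EuclideanSpace ℝ (Fin n)) (t : Z2 n) :
    t +ᵥ proj l x = proj l x ↔ ∃ w : ReflGroup n, rho l w = t ∧ w • x = x := by
  constructor
  · intro h
    obtain ⟨w, rfl⟩ := exists_rho_eq l t
    rw [vadd_proj rfl, proj_eq_iff] at h
    obtain ⟨k, hk, hkx⟩ := h
    exact ⟨k * w, by rw [rho_mul, hk, zero_add], by rw [mul_smul, hkx]⟩
  · rintro ⟨w, hw, hwx⟩
    rw [vadd_proj hw, hwx]

/-- An element of the reflection group fixing `x` is, in each coordinate, trivial or the reflection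
in the integer `x i`. The images of these reflections are the labels of the facets through the
folded point. -/
theorem fixed_iff_mem_labelSpan (m : Cover l) (t : Z2 n) :
    t +ᵥ m = m ↔ t ∈ labelSpan l (foldMap l m) := by
  obtain ⟨x, rfl⟩ := proj_surjective m
  constructor
  · intro h
    obtain ⟨w, rfl, hw⟩ := (fixed_proj_iff x t).1 h
    refine Submodule.sum_mem _ fun i _ => ?_
    have hi : w i • x i = x i := by rw [← ReflGroup.smul_apply, hw]
    rcases (Dinf.smul_eq_self_iff _ _).1 hi with h1 | ⟨h1, h2⟩
    · rw [h1, rhoCoord_one]; exact Submodule.zero_mem _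
    · have h3 : w i = ⟨-1, (w i).tr⟩ := Dinf.ext h1 rfl
      rw [h3, rhoCoord_reflection]
      refine Submodule.subset_span ⟨_, ?_, rfl⟩
      change Dinf.fold (x i) = bdry (decide (Odd (w i).tr))
      rw [h2, Dinf.fold_intCast]
      simp
  · intro h
    have : labelSpan l (foldMap l (proj l x)) ≤
        AddSubgroup.toZModSubmodule 2 (AddAction.stabilizer (Z2 n) (proj l x)) := by
      rw [labelSpan, Submodule.span_le]
      rintro _ ⟨⟨i, b⟩, hF, rfl⟩
      change l (i, b) +ᵥ proj l x = proj l x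
      have hF' : Dinf.fold (x i) = bdry b := hF
      obtain ⟨m, hm⟩ := Dinf.exists_int_of_fold_eq hF'
      rw [hm, Dinf.fold_intCast] at hF'
      rw [fixed_proj_iff]
      refine ⟨Pi.mulSingle i ⟨-1, m⟩, ?_, ?_⟩
      · rw [rho, Finset.sum_eq_single i]
        · rw [Pi.mulSingle_eq_same, rhoCoord_reflection]
          congr 2
          cases b <;> simpa using hF'
        · intro j _ hj
          rw [Pi.mulSingle_eq_of_ne hj, rhoCoord_one]
        · simp
      · ext j
        rw [ReflGroup.smul_apply]
        by_cases hj : j = i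
        · subst hj
          rw [Pi.mulSingle_eq_same, Dinf.smul_eq_self_iff]
          exact Or.inr ⟨rfl, hm⟩
        · rw [Pi.mulSingle_eq_of_ne hj, one_smul]
    exact this h

theorem card_stabilizer (m : Cover l) :
    Nat.card (AddAction.stabilizer (Z2 n) m) = 2 ^ faceCodim (foldMap l m) := by
  rw [← card_labelSpan hl.out]
  exact Nat.card_congr (Equiv.subtypeEquivRight fun t => fixed_iff_mem_labelSpan m t)

/-- The finitely many translates of the image of the cube cover the quotient. -/
instance : CompactSpace (Cover l) := by
  constructor
  have : (Set.univ : Set (Cover l)) = ⋃ t : Z2 n, Set.range fun p => t +ᵥ proj l (ofCube p) := by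
    refine (Set.eq_univ_of_forall fun m => ?_).symm
    obtain ⟨t, p, rfl⟩ := exists_vadd_ofCube m
    exact Set.mem_iUnion.2 ⟨t, p, rfl⟩
  rw [this]
  exact isCompact_iUnion fun t => isCompact_range
    ((continuous_vadd t).comp (continuous_proj.comp continuous_ofCube))

end Cover

namespace Cover

variable {n : ℕ} {l : Facet n → Z2 n}

/-- The open cube `(-1, 1)ⁿ`. -/
def openBox (n : ℕ) : Set (EuclideanSpace ℝ (Fin n)) := {z | ∀ i, |z i| < 1}

theorem isOpen_openBox : IsOpen (openBox n) := by
  have : openBox n = ⋂ i, {z | |z i| < 1} := by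
    ext z; simp [openBox]
  rw [this]
  exact isOpen_iInter_of_finite fun i => isOpen_lt (by fun_prop) continuous_const

theorem standardAct_mem_openBox {s : Z2 n} {z : EuclideanSpace ℝ (Fin n)} (hz : z ∈ openBox n) :
    standardAct s z ∈ openBox n := by
  intro i
  simp only [standardAct]
  split_ifs
  · exact hz i
  · rw [abs_neg]; exact hz i

/-- The vertex moves to an integer point with coordinates of the same parity, and each coordinate
moves by less than `2`; so it does not move. -/
theorem smul_vtx_of_openBox {v : Fin n → Bool} {z z' : EuclideanSpace ℝ (Fin n)}
    (hz : z ∈ openBox n) (hz' : z' ∈ openBox n) {w : ReflGroup n}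
    (h : w • (z + vtx v) = z' + vtx v) : w • vtx v = vtx v := by
  ext i
  have hi : w i • (z i + vtx v i) = z' i + vtx v i := by
    rw [← PiLp.add_apply, ← ReflGroup.smul_apply, h, PiLp.add_apply]
  have h1 := abs_lt.1 (hz i)
  have h2 := abs_lt.1 (hz' i)
  obtain ⟨c, hc⟩ : ∃ c : ℤ, vtx v i = c := ⟨if v i then 1 else 0, by simp [vtx]⟩
  rw [ReflGroup.smul_apply]
  rw [hc] at hi ⊢
  rw [Dinf.smul_def] at hi ⊢
  rcases Int.units_eq_one_or (w i).sgn with hs | hs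
  · rw [hs] at hi ⊢
    push_cast at hi ⊢
    have h3 : ((w i).tr : ℝ) < 1 := by linarith
    have h4 : (-1 : ℝ) < (w i).tr := by linarith
    have h5 : (w i).tr = 0 := by
      have h3' : (w i).tr < 1 := by exact_mod_cast h3
      have h4' : -1 < (w i).tr := by exact_mod_cast h4
      omega
    rw [h5]; simp
  · rw [hs] at hi ⊢
    push_cast at hi ⊢
    have h3 : ((w i).tr : ℝ) < c + 1 := by linarith
    have h4 : (c - 1 : ℝ) < (w i).tr := by linarith
    have h5 : (w i).tr = c := by
      have h3' : (w i).tr < c + 1 := by exact_mod_cast h3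
      have h4' : c - 1 < (w i).tr := by exact_mod_cast h4
      omega
    rw [h5]; ring

theorem eq_refl_of_smul_vtx {v : Fin n → Bool} {w : ReflGroup n} (h : w • vtx v = vtx v) :
    ∃ s, w = refl v s := by
  classical
  refine ⟨fun i => if w i = 1 then 0 else 1, ?_⟩
  funext i
  have hi : w i • vtx v i = vtx v i := by rw [← ReflGroup.smul_apply, h]
  simp only [refl]
  rcases (Dinf.smul_eq_self_iff _ _).1 hi with h1 | ⟨h1, h2⟩
  · simp [h1]
  · have hne : w i ≠ 1 := by
      intro h0
      rw [h0, Dinf.one_sgn] at h1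
      exact absurd h1 (by decide)
    simp only [if_neg hne, one_ne_zero, if_false]
    refine Dinf.ext h1 ?_
    rw [← Int.cast_inj (α := ℝ), ← h2]
    simp [vtx]

/-- The parametrization of `Cover l` near a vertex. -/
def param (l : Facet n → Z2 n) (v : Fin n → Bool) (z : EuclideanSpace ℝ (Fin n)) : Cover l :=
  proj l (z + vtx v)

theorem continuous_param (v : Fin n → Bool) : Continuous (param l v) :=
  continuous_proj.comp (continuous_id.add continuous_const)

theorem isOpenMap_param (v : Fin n → Bool) : IsOpenMap (param l v) :=
  isOpenMap_proj.comp (isOpenMap_add_right (vtx v))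

variable [hl : Fact (IsCharacteristic l)]

/-- The stabilizer of a vertex consists of products of the `n` reflections through it, and
independence of their labels makes `rho` injective there. Hence the parametrization near the vertex
is injective. -/
theorem eq_one_of_smul_vtx {v : Fin n → Bool} {w : ReflGroup n} (h : w • vtx v = vtx v)
    (hw : rho l w = 0) : w = 1 := by
  obtain ⟨s, rfl⟩ := eq_refl_of_smul_vtx h
  rw [rho_refl] at hw
  have hs := Fintype.linearIndependent_iff.1 (hl.out v) s hw
  funext i
  simp [refl, hs i]

theorem injOn_param (v : Fin n → Bool) : Set.InjOn (param l v) (openBox n) := by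
  intro z hz z' hz' h
  obtain ⟨w, hw, hwz⟩ := (proj_eq_iff _ _).1 h
  rw [eq_one_of_smul_vtx (smul_vtx_of_openBox hz hz' hwz) hw, one_smul] at hwz
  exact add_right_cancel hwz

/-- The chart around a vertex. -/
noncomputable def vertexChart (l : Facet n → Z2 n) [Fact (IsCharacteristic l)] (v : Fin n → Bool) :
    OpenPartialHomeomorph (Cover l) (EuclideanSpace ℝ (Fin n)) :=
  (OpenPartialHomeomorph.ofContinuousOpen ((injOn_param (l := l) v).toPartialEquiv _ _)
    (continuous_param v).continuousOn (isOpenMap_param v) isOpen_openBox).symm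

theorem vertexChart_param (v : Fin n → Bool) {z : EuclideanSpace ℝ (Fin n)} (hz : z ∈ openBox n) :
    vertexChart l v (param l v z) = z := (vertexChart l v).right_inv hz

theorem vadd_param (v : Fin n → Bool) (t : Z2 n) (z : EuclideanSpace ℝ (Fin n)) :
    t +ᵥ param l v z = param l v (standardAct (vertexEquiv l v t) z) := vadd_proj_vertex v t z

theorem vertexChart_vadd (v : Fin n → Bool) (t : Z2 n) {m : Cover l}
    (hm : m ∈ (vertexChart l v).source) : t +ᵥ m ∈ (vertexChart l v).source ∧
      vertexChart l v (t +ᵥ m) = standardAct (vertexEquiv l v t) (vertexChart l v m) := by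
  obtain ⟨z, hz, rfl⟩ := hm
  rw [vadd_param]
  refine ⟨⟨_, standardAct_mem_openBox hz, rfl⟩, ?_⟩
  rw [vertexChart_param v hz, vertexChart_param v (standardAct_mem_openBox hz)]

theorem exists_mem_vertexChart_source (m : Cover l) :
    ∃ v : Fin n → Bool, m ∈ (vertexChart l v).source := by
  obtain ⟨t, p, rfl⟩ := exists_vadd_ofCube m
  -- Rounding to a nearest vertex keeps every coordinate difference at most `1 / 2`, inside the open
  -- box.
  refine ⟨fun i => decide (1 / 2 ≤ (p i : ℝ)), (vertexChart_vadd _ t ?_).1⟩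
  refine ⟨ofCube p - vtx _, fun i => ?_, by rw [param, sub_add_cancel]⟩
  have h0 : (0 : ℝ) ≤ p i := (p i).2.1
  have h1 : (p i : ℝ) ≤ 1 := (p i).2.2
  simp only [ofCube, vtx, PiLp.sub_apply, decide_eq_true_eq]
  rw [abs_lt]
  split_ifs with h
  · constructor <;> linarith
  · constructor <;> linarith

noncomputable instance : ChartedSpace (EuclideanSpace ℝ (Fin n)) (Cover l) where
  atlas := Set.range (vertexChart l)
  chartAt m := vertexChart l (exists_mem_vertexChart_source m).choose
  mem_chart_source m := (exists_mem_vertexChart_source m).choose_spec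
  chart_mem_atlas _ := ⟨_, rfl⟩

/-- An element of the reflection group is smooth when read in charts. -/
theorem contDiffOn_vertexChart_proj_smul (w : ReflGroup n) (v v' : Fin n → Bool) :
    ContDiffOn ℝ ∞ (fun z => vertexChart l v' (proj l (w • (z + vtx v))))
      {z | proj l (w • (z + vtx v)) ∈ (vertexChart l v').source} := by
  rintro z₀ ⟨z', hz', hz⟩
  -- Near `z₀` a single kernel element `k` brings the points into the box around `v'`, so the chart
  -- expression is locally affine.
  obtain ⟨k, hk, hkz⟩ := (proj_eq_iff _ _).1 hz.symm
  have hg : ContDiff ℝ ∞ fun z => k • w • (z + vtx v) - vtx v' :=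
    ((ReflGroup.contDiff_smul k).comp ((ReflGroup.contDiff_smul w).comp
      (contDiff_id.add contDiff_const))).sub contDiff_const
  have hg0 : k • w • (z₀ + vtx v) - vtx v' = z' := by rw [hkz, add_sub_cancel_right]
  have hnear : ∀ᶠ z in nhds z₀, k • w • (z + vtx v) - vtx v' ∈ openBox n :=
    hg.continuous.continuousAt.eventually_mem (isOpen_openBox.mem_nhds (by rw [hg0]; exact hz'))
  refine ContDiffAt.contDiffWithinAt (hg.contDiffAt.congr_of_eventuallyEq ?_)
  filter_upwards [hnear] with z hz
  have h1 : proj l (w • (z + vtx v)) = param l v' (k • w • (z + vtx v) - vtx v') := by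
    rw [param, sub_add_cancel, proj_eq_iff]
    exact ⟨k, hk, rfl⟩
  rw [h1, vertexChart_param v' hz]

instance : IsManifold (𝓡 n) ∞ (Cover l) := by
  apply isManifold_of_contDiffOn
  rintro _ _ ⟨v, rfl⟩ ⟨v', rfl⟩
  have h := contDiffOn_vertexChart_proj_smul (l := l) 1 v v'
  simp only [one_smul] at h
  refine h.mono ?_
  rintro z ⟨⟨-, hz⟩, -⟩
  exact hz

theorem contMDiff_vadd (t : Z2 n) : ContMDiff (𝓡 n) (𝓡 n) ∞ fun m : Cover l => t +ᵥ m := by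
  rw [contMDiff_iff]
  refine ⟨continuous_vadd t, fun m m' => ?_⟩
  obtain ⟨w, rfl⟩ := exists_rho_eq l t
  have hfun : ∀ v z, rho l w +ᵥ param l v z = proj l (w • (z + vtx v)) := fun v z =>
    vadd_proj rfl _
  refine (contDiffOn_vertexChart_proj_smul (l := l) w (exists_mem_vertexChart_source m).choose
    (exists_mem_vertexChart_source m').choose).congr_mono ?_ ?_
  · intro z _
    simp only [← hfun]
    rfl
  · rintro z ⟨-, hz⟩
    change proj l (w • (z + vtx _)) ∈
      (vertexChart l (exists_mem_vertexChart_source m').choose).source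
    rw [← hfun]
    rw [extChartAt_source] at hz
    exact hz

/-- The small cover with a given characteristic function. -/
noncomputable def smallCover (l : Facet n → Z2 n) [Fact (IsCharacteristic l)] : SmallCover n where
  carrier := Cover l
  smooth_vadd := contMDiff_vadd
  locally_standard m := by
    obtain ⟨v, hv⟩ := exists_mem_vertexChart_source m
    exact ⟨vertexChart l v, IsManifold.subset_maximalAtlas ⟨v, rfl⟩, hv, vertexEquiv l v,
      fun t y hy => vertexChart_vadd v t hy⟩
  orbitSpace := by
    let f : AddAction.orbitRel.Quotient (Z2 n) (Cover l) → Cube n :=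
      Quotient.lift (foldMap l) fun m m' h =>
        ((foldMap_eq_iff m' m).2 h).symm
    have hf : Function.Bijective f := by
      constructor
      · rintro ⟨m⟩ ⟨m'⟩ h
        exact Quotient.sound ((foldMap_eq_iff m' m).1 (Eq.symm h))
      · intro p
        obtain ⟨m, rfl⟩ := foldMap_surjective (l := l) p
        exact ⟨Quotient.mk _ m, rfl⟩
    have hc : Continuous (Equiv.ofBijective f hf) := continuous_foldMap.quotient_lift _
    exact ⟨hc.homeoOfEquivCompactToT2, card_stabilizer⟩

theorem hasChar_smallCover (l : Facet n → Z2 n) [Fact (IsCharacteristic l)] :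
    HasChar (smallCover l) l :=
  ⟨foldMap l, ⟨continuous_foldMap, foldMap_surjective, foldMap_eq_iff, card_stabilizer⟩,
    fixed_iff_mem_labelSpan⟩

end Cover

/-- Every characteristic function is realized by a small cover. -/
theorem IsCharacteristic.exists_hasChar {n : ℕ} {l : Facet n → Z2 n} (hl : IsCharacteristic l) :
    ∃ M : SmallCover n, HasChar M l :=
  haveI : Fact (IsCharacteristic l) := ⟨hl⟩
  ⟨Cover.smallCover l, Cover.hasChar_smallCover l⟩

/-! ### Acyclic digraphs and characteristic functions -/

/-- Reachability in a finite acyclic digraph is well founded, and a minimal element of a set is a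
source in it. Conversely, the vertices lying on closed walks through a given vertex form a set
without a source. -/
theorem isAcyclic_iff_exists_source {V : Type} [Finite V] (G : Digraph V) :
    IsAcyclic G ↔ ∀ C : Finset V, C.Nonempty → ∃ j ∈ C, ∀ i ∈ C, ¬ G.Adj i j := by
  classical
  cases nonempty_fintype V
  constructor
  · intro h C hC
    have : Std.Irrefl (Relation.TransGen G.Adj) := ⟨h⟩
    obtain ⟨j, hj, hmin⟩ := (Finite.wellFounded_of_trans_of_irrefl
      (Relation.TransGen G.Adj)).has_min (C : Set V) hC
    exact ⟨j, hj, fun i hi hij => hmin i hi (Relation.TransGen.single hij)⟩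
  · intro h v hv
    obtain ⟨j, hj, hmin⟩ := h
      (Finset.univ.filter fun u => Relation.TransGen G.Adj v u ∧ Relation.TransGen G.Adj u v)
      ⟨v, by simp [hv]⟩
    simp only [Finset.mem_filter, Finset.mem_univ, true_and] at hj hmin
    obtain ⟨c, hvc, hcj⟩ := Relation.TransGen.tail'_iff.1 hj.1
    refine hmin c ⟨?_, Relation.TransGen.head hcj hj.2⟩ hcj
    rcases Relation.reflTransGen_iff_eq_or_transGen.1 hvc with rfl | hvc
    · exact hv
    · exact hvc

/-- A digraph with a directed cycle has an induced directed cycle. -/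
theorem exists_existsUnique_pred {V : Type} [Finite V] {G : Digraph V} (hG : ¬ IsAcyclic G) :
    ∃ C : Finset V, C.Nonempty ∧ ∀ j ∈ C, ∃! i, i ∈ C ∧ G.Adj i j := by
  classical
  rw [isAcyclic_iff_exists_source] at hG
  push Not at hG
  obtain ⟨C, ⟨hne, hpred⟩, hmin⟩ := Set.Finite.exists_minimal (Set.toFinite
    {C : Finset V | C.Nonempty ∧ ∀ j ∈ C, ∃ i ∈ C, G.Adj i j}) hG
  -- For a choice `f` of predecessors in the minimal set `C`, every vertex of the image again has a
  -- predecessor in the image. By minimality `f` maps `C` onto itself.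
  have himage : ∀ f : V → V, (∀ j ∈ C, f j ∈ C ∧ G.Adj (f j) j) → C.image f = C := by
    intro f hf
    have hsub : C.image f ⊆ C := Finset.image_subset_iff.2 fun j hj => (hf j hj).1
    refine Finset.Subset.antisymm hsub (hmin ⟨hne.image f, fun j hj => ?_⟩ hsub)
    obtain ⟨i, hi, rfl⟩ := Finset.mem_image.1 hj
    exact ⟨f (f i), Finset.mem_image_of_mem f (hf i hi).1, (hf _ (hf i hi).1).2⟩
  refine ⟨C, hne, fun j hj => ?_⟩
  obtain ⟨i, hi, hij⟩ := hpred j hj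
  refine ⟨i, ⟨hi, hij⟩, fun i' ⟨hi', hij'⟩ => ?_⟩
  by_contra hne'
  have hex : ∀ k, ∃ m, k ∈ C → m ∈ C ∧ G.Adj m k := by
    intro k
    by_cases hk : k ∈ C
    · obtain ⟨m, hm⟩ := hpred k hk
      exact ⟨m, fun _ => hm⟩
    · exact ⟨k, fun h => absurd h hk⟩
  choose f hf using hex
  have hupd : ∀ m, m ∈ C → G.Adj m j → ∀ k ∈ C,
      Function.update f j m k ∈ C ∧ G.Adj (Function.update f j m k) k := by
    intro m hm hmj k hk
    by_cases hkj : k = j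
    · subst hkj; simpa using ⟨hm, hmj⟩
    · simpa [hkj] using hf k hk
  -- Two predecessors `i ≠ i'` of `j` give two choices that differ only at `j`. The first attains
  -- `i'` at some `k ≠ j`, so the second attains it at both `k` and `j`; but a surjection of the
  -- finite set `C` onto itself is injective.
  have h1 := himage _ (hupd i hi hij)
  have h2 := himage _ (hupd i' hi' hij')
  rw [← h1] at hi'
  obtain ⟨k, hk, hki⟩ := Finset.mem_image.1 hi'
  have hkj : k ≠ j := by
    rintro rfl
    rw [Function.update_self] at hki
    exact hne' hki.symm
  rw [Function.update_of_ne hkj] at hki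
  have hinj : Set.InjOn (Function.update f j i') C := by
    rw [← Finset.card_image_iff, h2]
  exact hkj (hinj hk hj (by rw [Function.update_of_ne hkj, Function.update_self, hki]))

open Classical in
/-- The labelling of the facets given by a family of vectors and a digraph. -/
noncomputable def labelOf {n : ℕ} (b : Fin n → Z2 n) (G : Digraph (Fin n)) (F : Facet n) : Z2 n :=
  b F.1 + ∑ j, (if F.2 = true ∧ G.Adj F.1 j then (1 : ZMod 2) else 0) • b j

theorem labelOf_false {n : ℕ} (b : Fin n → Z2 n) (G : Digraph (Fin n)) (i : Fin n) :
    labelOf b G (i, false) = b i := by simp [labelOf]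

open Classical in
theorem labelOf_true {n : ℕ} (b : Fin n → Z2 n) (G : Digraph (Fin n)) (i : Fin n) :
    labelOf b G (i, true) = b i + ∑ j, (if G.Adj i j then (1 : ZMod 2) else 0) • b j := by
  simp [labelOf]

open Classical in
theorem sum_smul_labelOf {n : ℕ} (b : Fin n → Z2 n) (G : Digraph (Fin n)) (g : Fin n → ZMod 2)
    (v : Fin n → Bool) : ∑ i, g i • labelOf b G (i, v i) =
      ∑ j, (g j + ∑ i, if v i = true ∧ G.Adj i j then g i else 0) • b j := by
  simp only [labelOf, smul_add, Finset.sum_add_distrib, add_smul, Finset.smul_sum, Finset.sum_smul]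
  congr 1
  rw [Finset.sum_comm]
  refine Finset.sum_congr rfl fun j _ => Finset.sum_congr rfl fun i _ => ?_
  split_ifs <;> simp

/-- If the digraph is acyclic, the support of a nontrivial relation contains a vertex `j` with no
predecessor in the support, and the coefficient of `b j` is then `g j ≠ 0`. An induced cycle
conversely gives an explicit relation. -/
theorem isCharacteristic_labelOf_iff {n : ℕ} {b : Fin n → Z2 n} (hb : LinearIndependent (ZMod 2) b)
    (G : Digraph (Fin n)) : IsCharacteristic (labelOf b G) ↔ IsAcyclic G := by
  classical
  constructor
  · intro h
    by_contra hG
    obtain ⟨C, ⟨c, hc⟩, hpred⟩ := exists_existsUnique_pred hG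
    -- At the vertex given by the indicator of `C`, the coefficients are `1` on `C`, and off `C` the
    -- number of predecessors in `C`. The coefficient of `b j` then cancels modulo 2: off `C` by
    -- construction, on `C` because there is exactly one predecessor in `C`.
    have hli := Fintype.linearIndependent_iff.1 (h fun i => decide (i ∈ C))
      (fun i => if i ∈ C then 1 else ∑ k, if k ∈ C ∧ G.Adj k i then 1 else 0) ?_ c
    · simp [hc] at hli
    rw [sum_smul_labelOf]
    refine Finset.sum_eq_zero fun j _ => ?_
    have hsum : (∑ i, if decide (i ∈ C) = true ∧ G.Adj i j then
        (if i ∈ C then (1 : ZMod 2) else ∑ k, if k ∈ C ∧ G.Adj k i then 1 else 0) else 0) =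
        ∑ k, if k ∈ C ∧ G.Adj k j then 1 else 0 := by
      refine Finset.sum_congr rfl fun i _ => ?_
      by_cases hi : i ∈ C <;> simp [hi]
    rw [hsum]
    by_cases hj : j ∈ C
    · obtain ⟨i, hi, huniq⟩ := hpred j hj
      rw [if_pos hj, Finset.sum_eq_single i, if_pos hi, CharTwo.add_self_eq_zero, zero_smul]
      · intro k _ hk
        exact if_neg fun h => hk (huniq k h)
      · simp
    · rw [if_neg hj, CharTwo.add_self_eq_zero, zero_smul]
  · intro hG v
    rw [Fintype.linearIndependent_iff]
    intro g hg
    rw [sum_smul_labelOf] at hg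
    have hcoef := Fintype.linearIndependent_iff.1 hb _ hg
    by_contra hne
    push Not at hne
    obtain ⟨i₀, hi₀⟩ := hne
    obtain ⟨j, hj, hmin⟩ := (isAcyclic_iff_exists_source G).1 hG
      (Finset.univ.filter fun i => g i ≠ 0) ⟨i₀, by simpa using hi₀⟩
    simp only [Finset.mem_filter, Finset.mem_univ, true_and] at hj hmin
    have h := hcoef j
    rw [Finset.sum_eq_zero, add_zero] at h
    · exact hj h
    · intro i _
      split_ifs with hij
      · by_contra hgi
        exact hmin i hgi hij.2
      · rfl

theorem labelOf_true_eq_false_iff {n : ℕ} {b : Fin n → Z2 n} (hb : LinearIndependent (ZMod 2) b)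
    (G : Digraph (Fin n)) (i : Fin n) :
    labelOf b G (i, true) = labelOf b G (i, false) ↔ ∀ j, ¬ G.Adj i j := by
  classical
  rw [labelOf_true, labelOf_false, add_eq_left]
  constructor
  · intro h j hj
    have := Fintype.linearIndependent_iff.1 hb _ h j
    simp [hj] at this
  · intro h
    simp [h]

theorem labelOf_injective {n : ℕ} {b b' : Fin n → Z2 n} (hb : LinearIndependent (ZMod 2) b)
    {G G' : Digraph (Fin n)} (h : labelOf b G = labelOf b' G') : b = b' ∧ G = G' := by
  classical
  have hbb : b = b' := by
    funext i
    rw [← labelOf_false b G, h, labelOf_false]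
  subst hbb
  refine ⟨rfl, ?_⟩
  ext i j
  have h1 := congrFun h (i, true)
  rw [labelOf_true, labelOf_true, add_right_inj] at h1
  have h2 := hb.eq_coords_of_eq h1 j
  by_cases hij : G.Adj i j <;> by_cases hij' : G'.Adj i j <;> simp [hij, hij'] at h2 ⊢

theorem exists_labelOf_eq {n : ℕ} {l : Facet n → Z2 n}
    (hl : LinearIndependent (ZMod 2) fun i => l (i, false)) :
    ∃ G, labelOf (fun i => l (i, false)) G = l := by
  classical
  let B := basisOfLinearIndependentOfCardEqFinrank' _ hl (by simp)
  have hB : ∀ j, B j = l (j, false) := fun j => by simp [B]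
  refine ⟨⟨fun i j => B.repr (l (i, true) - l (i, false)) j = 1⟩, ?_⟩
  funext ⟨i, c⟩
  cases c
  · rw [labelOf_false]
  · rw [labelOf_true, ← eq_sub_iff_add_eq']
    refine Eq.trans ?_ (B.sum_repr (l (i, true) - l (i, false)))
    refine Finset.sum_congr rfl fun j _ => ?_
    rw [hB]
    dsimp only
    rcases ZMod_two_cases (B.repr (l (i, true) - l (i, false)) j) with h | h
    · rw [if_neg (by rw [h]; exact zero_ne_one), h]
    · rw [if_pos h, h]

theorem card_linearIndependent_Z2 (n : ℕ) :
    Nat.card {b : Fin n → Z2 n // LinearIndependent (ZMod 2) b} =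
      ∏ i ∈ Finset.range n, (2 ^ n - 2 ^ i) := by
  rw [card_linearIndependent (by simp)]
  simp only [ZMod.card, Module.finrank_fintype_fun_eq_card, Fintype.card_fin]
  exact Fin.prod_univ_eq_prod_range (fun i => 2 ^ n - 2 ^ i) n

/-- Equality of the two labels in direction `i` says that `i` is a sink. The set `T` collects the
directions that the later symmetry does not reverse. -/
theorem card_isCharacteristic {n : ℕ} (T : Finset (Fin n)) :
    Nat.card {l : Facet n → Z2 n // IsCharacteristic l ∧ ∀ i ∉ T, l (i, true) = l (i, false)} =
      Nat.card {b : Fin n → Z2 n // LinearIndependent (ZMod 2) b} *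
      Nat.card {G : Digraph (Fin n) // IsAcyclic G ∧ ∀ i ∉ T, ∀ j, ¬ G.Adj i j} := by
  rw [← Nat.card_prod]
  symm
  refine Nat.card_congr (Equiv.ofBijective
    (fun x => ⟨labelOf x.1.1 x.2.1, (isCharacteristic_labelOf_iff x.1.2 _).2 x.2.2.1,
      fun i hi => (labelOf_true_eq_false_iff x.1.2 _ i).2 (x.2.2.2 i hi)⟩) ⟨?_, ?_⟩)
  · rintro ⟨⟨b, hb⟩, G, hG⟩ ⟨⟨b', hb'⟩, G', hG'⟩ h
    obtain ⟨rfl, rfl⟩ := labelOf_injective hb (congrArg Subtype.val h)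
    rfl
  · rintro ⟨l, hl, hT⟩
    have hb := hl fun _ => false
    obtain ⟨G, hG⟩ := exists_labelOf_eq hb
    refine ⟨⟨⟨_, hb⟩, G, ?_, fun i hi => ?_⟩, Subtype.ext hG⟩
    · rwa [← isCharacteristic_labelOf_iff hb, hG]
    · rw [← labelOf_true_eq_false_iff hb, hG]
      exact hT i hi

theorem IsAcyclic.comap {V W : Type} {G : Digraph V} {H : Digraph W} (f : W → V)
    (hf : ∀ a b, H.Adj a b → G.Adj (f a) (f b)) (hG : IsAcyclic G) : IsAcyclic H :=
  fun w hw => hG (f w) (hw.lift f hf)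

theorem card_acyclic_congr {V W : Type} (e : V ≃ W) :
    Nat.card {G : Digraph V // IsAcyclic G} = Nat.card {G : Digraph W // IsAcyclic G} :=
  Nat.card_congr
    { toFun := fun G => ⟨⟨fun a b => G.1.Adj (e.symm a) (e.symm b)⟩,
        G.2.comap e.symm fun _ _ h => h⟩
      invFun := fun G => ⟨⟨fun a b => G.1.Adj (e a) (e b)⟩, G.2.comap e fun _ _ h => h⟩
      left_inv := fun G => by simp
      right_inv := fun G => by simp }

/-- A digraph whose edges all start in `T` is acyclic if its restriction to `T` is. -/
theorem isAcyclic_of_restrict {V : Type} {G : Digraph V} {T : Finset V}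
    (hT : ∀ i j, G.Adj i j → i ∈ T)
    (h : IsAcyclic (⟨fun a b => G.Adj a.1 b.1⟩ : Digraph T)) : IsAcyclic G := by
  have key : ∀ a b, ∀ hb : b ∈ T, Relation.TransGen G.Adj a b → ∃ ha : a ∈ T,
      Relation.TransGen (fun a b : T => G.Adj a.1 b.1) ⟨a, ha⟩ ⟨b, hb⟩ := by
    intro a b hb hab
    induction hab using Relation.TransGen.head_induction_on with
    | single h => exact ⟨hT _ _ h, Relation.TransGen.single h⟩
    | head h _ ih =>
      obtain ⟨hc, hcb⟩ := ih
      exact ⟨hT _ _ h, Relation.TransGen.head h hcb⟩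
  intro v hv
  obtain ⟨c, hc, -⟩ := Relation.TransGen.head'_iff.1 hv
  obtain ⟨hv', h'⟩ := key v v (hT _ _ hc) hv
  exact h _ h'

open Classical in
-- No edge starts outside `T`, so edges from `T` to its complement can never lie on a cycle and are
-- arbitrary; only the restriction to `T` must be acyclic.
theorem card_acyclic_sinks {n : ℕ} (T : Finset (Fin n)) :
    Nat.card {G : Digraph (Fin n) // IsAcyclic G ∧ ∀ i ∉ T, ∀ j, ¬ G.Adj i j} =
      2 ^ (T.card * (n - T.card)) * numAcyclicDigraphs T.card := by
  have e : {G : Digraph (Fin n) // IsAcyclic G ∧ ∀ i ∉ T, ∀ j, ¬ G.Adj i j} ≃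
      (T → {i // i ∉ T} → Prop) × {G : Digraph T // IsAcyclic G} :=
    { toFun := fun G => ⟨fun a b => G.1.Adj a.1 b.1, ⟨fun a b => G.1.Adj a.1 b.1⟩,
        G.2.1.comap Subtype.val fun _ _ h => h⟩
      invFun := fun x => ⟨⟨fun i j => ∃ hi : i ∈ T, if hj : j ∈ T then x.2.1.Adj ⟨i, hi⟩ ⟨j, hj⟩
          else x.1 ⟨i, hi⟩ ⟨j, hj⟩⟩, by
        refine ⟨isAcyclic_of_restrict (T := T) (fun i j h => h.1) ?_, fun i hi j h => hi h.1⟩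
        refine x.2.2.comap id fun a b h => ?_
        simpa using h⟩
      left_inv := fun G => by
        apply Subtype.ext
        ext i j
        constructor
        · rintro ⟨hi, h⟩
          split_ifs at h <;> exact h
        · intro h
          refine ⟨by_contra fun hi => G.2.2 i hi j h, ?_⟩
          split_ifs <;> exact h
      right_inv := fun x => by
        refine Prod.ext ?_ (Subtype.ext ?_)
        · funext a b
          simp [b.2]
        · ext a b
          simp }
  rw [Nat.card_congr e, Nat.card_prod, Nat.card_fun, Nat.card_fun, card_acyclic_congr T.equivFin,
    numAcyclicDigraphs]
  congr 1
  have h1 : Nat.card {i // i ∉ T} = n - T.card := by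
    rw [Nat.card_eq_fintype_card, Fintype.card_subtype_compl]
    simp
  rw [h1, ← pow_mul, mul_comm]
  simp

/-! ### Classification by orbits of characteristic functions -/

theorem eq_or_eq_opp_of_fst_eq {n : ℕ} {F F' : Facet n} (h : F.1 = F'.1) : F = F' ∨ F = opp F' := by
  obtain ⟨i, b⟩ := F
  obtain ⟨j, c⟩ := F'
  obtain rfl : i = j := h
  cases b <;> cases c <;> simp [opp]

theorem CubeAut.fst_injective {n : ℕ} {σ : Equiv.Perm (Facet n)} (hσ : σ ∈ CubeAut n)
    {F F' : Facet n} (h : (σ F).1 = (σ F').1) : F.1 = F'.1 := by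
  rcases eq_or_eq_opp_of_fst_eq h with h | h
  · rw [σ.injective h]
  · rw [← hσ] at h
    rw [σ.injective h]
    rfl

/-- A symmetry carries the facets at one vertex to the facets at another. The new vertex is defined
along the injection of directions, which is onto by finiteness, so the default `false` never
matters. -/
theorem IsCharacteristic.comp {n : ℕ} {l : Facet n → Z2 n} (hl : IsCharacteristic l)
    {σ : Equiv.Perm (Facet n)} (hσ : σ ∈ CubeAut n) : IsCharacteristic fun F => l (σ F) := by
  intro v
  have hinj : Function.Injective fun i => (σ (i, v i)).1 := fun i j h =>
    CubeAut.fst_injective hσ h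
  have h := (hl (Function.extend (fun i => (σ (i, v i)).1) (fun i => (σ (i, v i)).2)
    fun _ => false)).comp _ hinj
  convert h using 1
  funext i
  exact congrArg l (Prod.ext rfl (hinj.extend_apply (fun i => (σ (i, v i)).2)
    (fun _ => false) i).symm)

/-- The characteristic functions on the facets of the cube. -/
abbrev CharFun (n : ℕ) : Type := {l : Facet n → Z2 n // IsCharacteristic l}

instance (n : ℕ) : MulAction (CubeAut n) (CharFun n) where
  smul σ l := ⟨fun F => l.1 (σ.1⁻¹ F), l.2.comp ((CubeAut n).inv_mem σ.2)⟩
  one_smul l := rfl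
  mul_smul σ τ l := by
    apply Subtype.ext
    funext F
    change l.1 ((σ.1 * τ.1)⁻¹ F) = l.1 (τ.1⁻¹ (σ.1⁻¹ F))
    rw [mul_inv_rev]
    rfl

theorem CharFun.smul_apply {n : ℕ} (σ : CubeAut n) (l : CharFun n) (F : Facet n) :
    (σ • l).1 F = l.1 (σ.1⁻¹ F) := rfl

theorem hasChar_smul_iff_mem_orbit {n : ℕ} {M : SmallCover n} {l k : CharFun n}
    (hl : HasChar M l.1) : HasChar M k.1 ↔ k ∈ MulAction.orbit (CubeAut n) l := by
  constructor
  · intro hk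
    obtain ⟨σ, hσ, h⟩ := hl.exists_cubeAut l.2 hk
    exact ⟨⟨σ, hσ⟩, Subtype.ext (funext fun F => (h F).symm)⟩
  · rintro ⟨σ, rfl⟩
    exact hl.comp_inv σ.2

/-- Small covers are classified by their characteristic functions up to symmetries of the cube. -/
theorem nonempty_equiv_orbits (n : ℕ) : Nonempty (Quotient (SmallCover.setoid n) ≃
    MulAction.orbitRel.Quotient (CubeAut n) (CharFun n)) := by
  choose l hl hMl using fun M : SmallCover n => M.exists_hasChar
  let c : SmallCover n → CharFun n := fun M => ⟨l M, hl M⟩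
  have hc : ∀ M, HasChar M (c M).1 := hMl
  have hwd : ∀ M N : SmallCover n, M.EquivHomeo N →
      (Quotient.mk _ (c M) : MulAction.orbitRel.Quotient (CubeAut n) (CharFun n)) =
        Quotient.mk _ (c N) := by
    intro M N h
    exact Quotient.sound ((hasChar_smul_iff_mem_orbit (hc N)).1 ((hc M).congr h))
  refine ⟨Equiv.ofBijective (Quotient.lift (fun M => Quotient.mk _ (c M)) hwd) ⟨?_, ?_⟩⟩
  · rintro ⟨M⟩ ⟨N⟩ h
    have h' := Quotient.exact h
    exact Quotient.sound ((hc M).equivHomeo ((hasChar_smul_iff_mem_orbit (hc N)).2 h'))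
  · rintro ⟨k⟩
    obtain ⟨M, hM⟩ := k.2.exists_hasChar
    exact ⟨Quotient.mk _ M, Quotient.sound ((hasChar_smul_iff_mem_orbit hM).1 (hc M))⟩

/-! ### Counting orbits with Burnside's lemma -/

/-- The symmetry of the cube that permutes the coordinates by `π` and reverses those outside
`T`. -/
def cubeAutOf {n : ℕ} (x : Equiv.Perm (Fin n) × Finset (Fin n)) : CubeAut n :=
  ⟨Equiv.prodShear x.1 fun i => if i ∈ x.2 then Equiv.refl Bool else Equiv.boolNot, by
    rintro ⟨i, b⟩
    by_cases h : i ∈ x.2 <;> simp [opp, h]⟩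

theorem cubeAutOf_apply {n : ℕ} (x : Equiv.Perm (Fin n) × Finset (Fin n)) (i : Fin n) (b : Bool) :
    (cubeAutOf x).1 (i, b) = (x.1 i, if i ∈ x.2 then b else !b) := by
  by_cases h : i ∈ x.2 <;> simp [cubeAutOf, h]

theorem cubeAutOf_bijective (n : ℕ) : Function.Bijective (cubeAutOf (n := n)) := by
  constructor
  · rintro ⟨π, T⟩ ⟨π', T'⟩ h
    have h' : ∀ i, (π i, if i ∈ T then false else true) = (π' i, if i ∈ T' then false else true) := by
      intro i
      have := cubeAutOf_apply (π, T) i false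
      rw [h, cubeAutOf_apply] at this
      simpa using this.symm
    simp only [Prod.mk.injEq] at h'
    refine Prod.ext (Equiv.ext fun i => (h' i).1) (Finset.ext fun i => ?_)
    have := (h' i).2
    by_cases h1 : i ∈ T <;> by_cases h2 : i ∈ T' <;> simp [h1, h2] at this ⊢
  · rintro ⟨σ, hσ⟩
    have hinj : Function.Injective fun i => (σ (i, false)).1 := fun i j h =>
      CubeAut.fst_injective hσ h
    refine ⟨(Equiv.ofBijective _ (Finite.injective_iff_bijective.1 hinj),
      Finset.univ.filter fun i => (σ (i, false)).2 = false), ?_⟩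
    apply Subtype.ext
    ext1 ⟨i, b⟩
    rw [cubeAutOf_apply]
    have hopp : σ (i, true) = opp (σ (i, false)) := hσ (i, false)
    refine Prod.ext ?_ ?_
    · cases b
      · rfl
      · simp [hopp, opp]
    · cases b <;> cases h : (σ (i, false)).2 <;> simp [hopp, opp, h]

theorem card_cubeAut (n : ℕ) : Nat.card (CubeAut n) = 2 ^ n * n.factorial := by
  rw [← Nat.card_congr (Equiv.ofBijective _ (cubeAutOf_bijective n)), Nat.card_prod,
    Nat.card_perm, Nat.card_eq_fintype_card, Nat.card_eq_fintype_card]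
  simp [mul_comm]

theorem mem_fixedBy_iff {n : ℕ} (σ : CubeAut n) (l : CharFun n) :
    l ∈ MulAction.fixedBy (CharFun n) σ ↔ ∀ F, l.1 (σ.1 F) = l.1 F := by
  rw [MulAction.mem_fixedBy]
  constructor
  · intro h F
    have := CharFun.smul_apply σ l (σ.1 F)
    rw [h] at this
    simpa using this
  · intro h
    apply Subtype.ext
    funext F
    rw [CharFun.smul_apply, ← h]
    simp

/-- Facets in different directions share a vertex, where the labels are independent and hence
distinct. -/
theorem IsCharacteristic.eq_of_label_eq {n : ℕ} {l : Facet n → Z2 n} (hl : IsCharacteristic l)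
    {i j : Fin n} {b c : Bool} (h : l (i, b) = l (j, c)) : i = j := by
  by_contra hne
  have := (hl (Function.update (fun _ => c) i b)).injective (a₁ := i) (a₂ := j)
    (by simpa [Function.update_of_ne (Ne.symm hne)] using h)
  exact hne this

theorem card_fixedBy_of_ne {n : ℕ} {π : Equiv.Perm (Fin n)} (hπ : π ≠ 1) (T : Finset (Fin n)) :
    Nat.card (MulAction.fixedBy (CharFun n) (cubeAutOf (π, T))) = 0 := by
  have : IsEmpty (MulAction.fixedBy (CharFun n) (cubeAutOf (π, T))) := by
    constructor
    rintro ⟨l, hl⟩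
    rw [mem_fixedBy_iff] at hl
    apply hπ
    ext1 i
    have h := hl (i, false)
    rw [cubeAutOf_apply] at h
    exact l.2.eq_of_label_eq h
  exact Nat.card_of_isEmpty

/-- Invariance only constrains the reversed directions, those outside `T`, and there it equates the
labels of opposite facets. -/
theorem card_fixedBy_one {n : ℕ} (T : Finset (Fin n)) :
    Nat.card (MulAction.fixedBy (CharFun n) (cubeAutOf (1, T))) =
      (∏ i ∈ Finset.range n, (2 ^ n - 2 ^ i)) *
        (2 ^ (T.card * (n - T.card)) * numAcyclicDigraphs T.card) := by
  rw [← card_linearIndependent_Z2, ← card_acyclic_sinks, ← card_isCharacteristic]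
  refine Nat.card_congr ((Equiv.subtypeEquivRight fun l => ?_).trans
    (Equiv.subtypeSubtypeEquivSubtypeInter (fun l : Facet n → Z2 n => IsCharacteristic l)
      fun l => ∀ i ∉ T, l (i, true) = l (i, false)))
  rw [mem_fixedBy_iff]
  constructor
  · intro h i hi
    have := h (i, false)
    rw [cubeAutOf_apply] at this
    simpa [hi] using this
  · rintro h ⟨i, b⟩
    rw [cubeAutOf_apply]
    by_cases hi : i ∈ T
    · simp [hi]
    · cases b
      · simpa [hi] using h i hi
      · simpa [hi] using (h i hi).symm

/-- In Burnside's sum only the trivial coordinate permutation contributes. The remaining sum over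
`T` depends on the cardinality of `T` alone, which produces the binomial coefficients. -/
theorem card_orbits_mul (n : ℕ) :
    Nat.card (MulAction.orbitRel.Quotient (CubeAut n) (CharFun n)) * (2 ^ n * n.factorial) =
      (∏ i ∈ Finset.range n, (2 ^ n - 2 ^ i)) * ∑ k ∈ Finset.range (n + 1),
        n.choose k * (2 ^ (k * (n - k)) * numAcyclicDigraphs k) := by
  classical
  cases nonempty_fintype (MulAction.orbitRel.Quotient (CubeAut n) (CharFun n))
  have hB := MulAction.sum_card_fixedBy_eq_card_orbits_mul_card_group (CubeAut n) (CharFun n)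
  rw [← card_cubeAut, Nat.card_eq_fintype_card, Nat.card_eq_fintype_card]
  refine hB.symm.trans ?_
  simp only [← Nat.card_eq_fintype_card]
  rw [← (Equiv.ofBijective _ (cubeAutOf_bijective n)).sum_comp]
  simp only [Equiv.ofBijective_apply]
  rw [Fintype.sum_prod_type, Finset.sum_eq_single 1]
  · simp only [card_fixedBy_one, ← Finset.mul_sum]
    congr 1
    rw [← Finset.powerset_univ, Finset.sum_powerset_apply_card
      fun k => 2 ^ (k * (n - k)) * numAcyclicDigraphs k]
    simp
  · intro π _ hπ
    exact Finset.sum_eq_zero fun T _ => card_fixedBy_of_ne hπ T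
  · simp

end SmallCovers

theorem mainTheorem2 (n : ℕ) :
    Finite (Quotient (SmallCovers.SmallCover.setoid n)) ∧
    (SmallCovers.numSmallCovers n : ℚ) =
      (∑ k ∈ Finset.range (n + 1),
          (n.choose k : ℚ) * 2 ^ (k * (n - k)) * (SmallCovers.numAcyclicDigraphs k : ℚ)) /
        (2 ^ n * (n.factorial : ℚ)) *
      ∏ i ∈ Finset.range n, ((2 : ℚ) ^ n - 2 ^ i) := by
  obtain ⟨e⟩ := SmallCovers.nonempty_equiv_orbits n
  refine ⟨Finite.of_equiv _ e.symm, ?_⟩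
  rw [SmallCovers.numSmallCovers, Nat.card_congr e, div_mul_eq_mul_div, eq_div_iff (by positivity)]
  have h := congrArg (Nat.cast (R := ℚ)) (SmallCovers.card_orbits_mul n)
  push_cast at h
  rw [h, mul_comm]
  congr 1
  · exact Finset.sum_congr rfl fun k _ => by ring
  · refine Finset.prod_congr rfl fun i hi => ?_
    -- The truncated subtraction of the natural-number count is a true one because `i < n`.
    rw [Nat.cast_sub (Nat.pow_le_pow_right two_pos (Finset.mem_range.1 hi).le)]
    push_cast
    rfl
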